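/- Let $(\Omega,\mathcal F,\mathbb P)$ be a probability space, $n,d$ natural numbers, $\lambda\in\mathbb R^d_+$, and $Q\in\mathbb R^{d\times d}$ an intensity matrix in the convention that $Q_{ij}\ge 0$ $(i\ne j)$ is the intensity of a transition from state $j$ to state $i$, so that all column sums of $Q$ vanish. Let $X=(X_t)_{t\ge0}$ be a right-continuous process with left limits and with values in the set $\{e_1,\dots,e_d\}$ of standard basis vectors of $\mathbb R^d$, and let $\tau^1,\dots,\tau^n$ be random times with values in $[0,\infty]$. Put $Y^i_t=\mathbf 1_{\{\tau^i\le t\}}$ and $N_t=\sum_{i=1}^nY^i_t$. Let $\mathbb F=(\mathcal F_t)$ be the filtration generated by $X,Y^1,\dots,Y^n$, and $\mathbb F^i$ the filtration generated by $X$ and $Y^i$. Assume: 1. $X$ is a Markov chain with intensity matrix $Q$ with respect to $\mathbb F$, in the sense that $M^X_t=X_t-X_0-\int_0^tQX_r\,dr$ is an $\mathbb F$-martingale; 2. for each $i$, $m^i_t=Y^i_t-Y^i_0-\int_0^t\lambda^\top X_r\,(1-Y^i_r)\,dr$ is an $\mathbb F^i$-martingale; 3. $\tau^1,\dots,\tau^n$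 are conditionally independent given the $\sigma$-algebra generated by the whole path of $X$; 4. for each $i$, almost surely, $X$ and $Y^i$ have no simultaneous jumps. For $k\ge0$ write $Q_{k\lambda}=Q-k\,\mathrm{diag}(\lambda)$ and $\zeta^k_t=\mathbf 1_{\{N_t=k\}}X_t$, and let $\mathbf 1\in\mathbb R^d$ be the vector of ones. Then for all $u\in\mathbb R$ and $0\le s\le t$, almost surely, $$\mathbb E[e^{\mathrm iuN_t}X_t\mid\mathcal F_s]=\sum_{k=0}^n\sum_{j=k}^n\binom{n-k}{j-k}(1-e^{\mathrm iu})^{n-j}e^{\mathrm iuj}\exp\big(Q_{(n-j)\lambda}(t-s)\big)\,\zeta^k_s,$$ $$\mathbb E[e^{\mathrm iuN_t}\mid\mathcal F_s]=\sum_{k=0}^n\sum_{j=k}^n\binom{n-k}{j-k}(1-e^{\mathrm iu})^{n-j}e^{\mathrm iuj}\,\mathbf 1^\top\exp\big(Q_{(n-j)\lambda}(t-s)\big)\,\zeta^k_s.$$ -/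

import Mathlib

open MeasureTheory Filter Topology
open scoped NNReal ENNReal Matrix

noncomputable section

namespace MarkovModulated

variable {Ω : Type*} [mΩ : MeasurableSpace Ω] {n d : ℕ}

/-- The default indicator `Y^i_t = 1_{τ^i ≤ t}` (a default time may be infinite). -/
def defaultInd (τ : Fin n → Ω → ℝ≥0∞) (i : Fin n) (t : ℝ≥0) (ω : Ω) : ℝ :=
  if τ i ω ≤ (t : ℝ≥0∞) then 1 else 0

/-- The number of defaults `N_t = ∑ i, Y^i_t`. -/
def numDefaults (τ : Fin n → Ω → ℝ≥0∞) (t : ℝ≥0) (ω : Ω) : ℝ :=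
  ∑ i, defaultInd τ i t ω

/-- The `k`-th block `ζ^k_t = 1_{N_t = k} X_t` of `ζ_t = ν_t ⊗ X_t`. -/
def zetaBlock (X : ℝ≥0 → Ω → Fin d → ℝ) (τ : Fin n → Ω → ℝ≥0∞) (k : ℕ) (t : ℝ≥0) (ω : Ω) :
    Fin d → ℝ :=
  if numDefaults τ t ω = (k : ℝ) then X t ω else 0

/-- `Q_{kλ} = Q - k diag(λ)`. -/
def killedGen (Q : Matrix (Fin d) (Fin d) ℝ) (lam : Fin d → ℝ) (k : ℕ) :
    Matrix (Fin d) (Fin d) ℝ :=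
  Q - (k : ℝ) • Matrix.diagonal lam

/-- `Q i j`, `i ≠ j`, is the intensity of a transition from `j` to `i`: off-diagonal entries are
nonnegative and the column sums vanish. -/
structure IsIntensityMatrix (Q : Matrix (Fin d) (Fin d) ℝ) : Prop where
  offDiag_nonneg : ∀ i j, i ≠ j → 0 ≤ Q i j
  col_sum : ∀ j, ∑ i, Q i j = 0

lemma measurable_defaultInd {τ : Fin n → Ω → ℝ≥0∞} (hτ : ∀ i, Measurable (τ i))
    (i : Fin n) (t : ℝ≥0) : Measurable (defaultInd τ i t) :=
  Measurable.ite (measurableSet_le (hτ i) measurable_const) measurable_const measurable_const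

/-- The filtration `𝔽` generated by the chain `X` and all default indicators `Y^1, …, Y^n`. -/
def fullFiltration (X : ℝ≥0 → Ω → Fin d → ℝ) (τ : Fin n → Ω → ℝ≥0∞)
    (hX : ∀ t, Measurable (X t)) (hτ : ∀ i, Measurable (τ i)) : Filtration ℝ≥0 mΩ :=
  Filtration.natural (fun t ω => (X t ω, fun i => defaultInd τ i t ω)) fun t =>
    ((hX t).prodMk
      (measurable_pi_lambda _ fun i => measurable_defaultInd hτ i t)).stronglyMeasurable

/-- The filtration `𝔽^i` generated by the chain `X` and the single default indicator `Y^i`. -/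
def obligorFiltration (X : ℝ≥0 → Ω → Fin d → ℝ) (τ : Fin n → Ω → ℝ≥0∞)
    (hX : ∀ t, Measurable (X t)) (hτ : ∀ i, Measurable (τ i)) (i : Fin n) :
    Filtration ℝ≥0 mΩ :=
  Filtration.natural (fun t ω => (X t ω, defaultInd τ i t ω)) fun t =>
    ((hX t).prodMk (measurable_defaultInd hτ i t)).stronglyMeasurable

/-- The σ-algebra generated by the whole path of `X`. -/
abbrev pathSigma (X : ℝ≥0 → Ω → Fin d → ℝ) : MeasurableSpace Ω :=
  ⨆ t, MeasurableSpace.comap (X t) inferInstance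

/-- Conditional independence of the `τ^i` given `m`, through conditional probabilities. (Mathlib's
`iCondIndepFun` is only available on standard Borel spaces.) -/
def CondIndepTimes (μ : Measure Ω) (m : MeasurableSpace Ω) (τ : Fin n → Ω → ℝ≥0∞) : Prop :=
  ∀ B : Fin n → Set ℝ≥0∞, (∀ i, MeasurableSet (B i)) →
    μ[(⋂ i, τ i ⁻¹' B i).indicator (fun _ => (1 : ℝ)) | m] =ᵐ[μ]
      fun ω => ∏ i, (μ[(τ i ⁻¹' B i).indicator (fun _ => (1 : ℝ)) | m]) ω

/-- `M^X_t = X_t - X_0 - ∫_0^t Q X_r dr`. -/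
def chainNoise (Q : Matrix (Fin d) (Fin d) ℝ) (X : ℝ≥0 → Ω → Fin d → ℝ) (t : ℝ≥0) (ω : Ω) :
    Fin d → ℝ :=
  X t ω - X 0 ω - ∫ r in (0 : ℝ)..(t : ℝ), Q *ᵥ X r.toNNReal ω

/-- `m^i_t = Y^i_t - Y^i_0 - ∫_0^t (λᵀ X_r) (1 - Y^i_r) dr`. -/
def defaultNoise (lam : Fin d → ℝ) (X : ℝ≥0 → Ω → Fin d → ℝ) (τ : Fin n → Ω → ℝ≥0∞)
    (i : Fin n) (t : ℝ≥0) (ω : Ω) : ℝ :=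
  defaultInd τ i t ω - defaultInd τ i 0 ω -
    ∫ r in (0 : ℝ)..(t : ℝ),
      (lam ⬝ᵥ X r.toNNReal ω) * (1 - defaultInd τ i r.toNNReal ω)

/-- The jump `Δf_t = f_t - f_{t-}` of a path with left limits (zero at `t = 0`). -/
def jump {E : Type*} [TopologicalSpace E] [Sub E] (f : ℝ≥0 → E) (t : ℝ≥0) : E :=
  f t - Function.leftLim f t

/-- The Markov modulated model for `n` obligors with default times `τ^1, …, τ^n`, intensity matrix
`Q` and common default intensity `λᵀ X_t`. -/
structure IsObligorModel (μ : Measure Ω) (Q : Matrix (Fin d) (Fin d) ℝ) (lam : Fin d → ℝ)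
    (X : ℝ≥0 → Ω → Fin d → ℝ) (τ : Fin n → Ω → ℝ≥0∞)
    (hX : ∀ t, Measurable (X t)) (hτ : ∀ i, Measurable (τ i)) : Prop where
  /-- `X` takes its values in the set of standard basis vectors. -/
  basis_valued : ∀ t ω, ∃ k : Fin d, X t ω = Pi.single k 1
  right_continuous : ∀ ω t, ContinuousWithinAt (fun r => X r ω) (Set.Ici t) t
  left_limits : ∀ ω t, ∃ x, Tendsto (fun r => X r ω) (𝓝[<] t) (𝓝 x)
  /-- `dX_t = Q X_t dt + dM^X_t`: `X` is a Markov chain with intensity matrix `Q`. -/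
  chain_martingale : Martingale (chainNoise Q X) (fullFiltration X τ hX hτ) μ
  /-- `dY^i_t = (λᵀ X_t) (1 - Y^i_t) dt + dm^i_t`. -/
  default_martingale :
    ∀ i, Martingale (defaultNoise lam X τ i) (obligorFiltration X τ hX hτ i) μ
  /-- The default times are conditionally independent given the modulating process. -/
  condIndep : CondIndepTimes μ (pathSigma X) τ
  /-- `X` and `Y^i` have no simultaneous jumps. -/
  no_common_jumps : ∀ i, ∀ᵐ ω ∂μ, ∀ t,
    jump (fun r => defaultInd τ i r ω) t • jump (fun r => X r ω) t = 0

end MarkovModulated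

end

/-! Since each indicator is 0 or 1, `e^{iuY} = (1 - e^{iu})(1 - Y) + e^{iu}`. Multiplying over the
obligors expands `e^{iuN_t}` into a sum over sets `A` of obligors, with coefficients depending only
on `|A|`, of the survival products `∏_{i ∈ A} (1 - Y^i_t)`. It therefore suffices to show that,
tested on events of `F_s`, `X_t ∏_A (1 - Y^i_t)` may be replaced by `exp((t - s) Q_{|A|λ}) X_s ∏_A
(1 - Y^i_s)`; this is `setIntegral_path_mul_prod_survival`. On `{N_s = k}` only sets of survivors
count, and there are `C(n-k, n-j) = C(n-k, j-k)` of size `n - j`, which gives the stated binomials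
(`sum_subsets_eq_sum_blocks`).

For a single obligor, both `X (1 - Y^i)` and `X e^{-∫λᵀX} (1 - Y^i_0)` evolve linearly with
generator `Q - diag λ`: the first by the default martingale and the absence of common jumps, the
second by Feynman-Kac. Their difference starts at zero. Propagating it through the successive times
of a cylinder event keeps it at zero, because `X` is basis-valued and so an event at one time merely
multiplies each coordinate by a constant. Hence `P(τ^i > t | X) = e^{-∫_0^t λᵀX} P(τ^i > 0 | X)`
(`setIntegral_survival`).

Conditional independence multiplies these probabilities. Given `F_s` together with the whole path,
the product over `A` at time `t` is `e^{-|A| ∫_s^t λᵀX}` times the product at time `s`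
(`setIntegral_prod_survival`). Integrating out the future path by Feynman-Kac along `F` with
potential `|A| λ` yields the matrix exponential.

No stochastic calculus enters. Each linear evolution comes from `eq_exp_mulVec_of_increment`, a
discrete Grönwall argument on uniform partitions: increments agree with the linear equation up to
`O(h²)` plus a covariation term whose sum vanishes (`integral_path_mul_eq_exp`). -/

noncomputable section

namespace MarkovModulated

/-! ### Linear equations from increments along uniform partitions. -/

section Euler

open scoped Matrix.Norms.Operator

variable {d : ℕ}

/-- The `k`-th point of the uniform partition of `[s, t]` into `m` pieces. -/
def gridPoint (s t : ℝ≥0) (m k : ℕ) : ℝ≥0 := s + k * ((t - s) / m)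

lemma gridPoint_mono (s t : ℝ≥0) (m : ℕ) : Monotone (gridPoint s t m) := by
  intro a b hab
  unfold gridPoint
  gcongr

@[simp] lemma gridPoint_zero (s t : ℝ≥0) (m : ℕ) : gridPoint s t m 0 = s := by
  simp [gridPoint]

lemma gridPoint_last {s t : ℝ≥0} (hst : s ≤ t) {m : ℕ} (hm : m ≠ 0) : gridPoint s t m m = t := by
  have : (m : ℝ≥0) ≠ 0 := by exact_mod_cast hm
  rw [gridPoint, mul_div_cancel₀ _ this, add_tsub_cancel_of_le hst]

lemma coe_gridPoint {s t : ℝ≥0} (hst : s ≤ t) (m k : ℕ) :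
    (gridPoint s t m k : ℝ) = s + k * (((t : ℝ) - s) / m) := by
  simp [gridPoint, NNReal.coe_sub hst]

lemma coe_gridPoint_succ_sub {s t : ℝ≥0} (hst : s ≤ t) (m k : ℕ) :
    (gridPoint s t m (k + 1) : ℝ) - gridPoint s t m k = ((t : ℝ) - s) / m := by
  rw [coe_gridPoint hst, coe_gridPoint hst]
  push_cast
  ring

/-- Differentiability of the exponential at 0 makes the error of one Euler step `o(1/m)`; the factor
`m` counts the steps. -/
lemma tendsto_mul_norm_exp_sub (K : Matrix (Fin d) (Fin d) ℝ) (c : ℝ) :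
    Tendsto (fun m : ℕ => (m : ℝ) *
      ‖NormedSpace.exp ((c / m) • K) - 1 - (c / m) • K‖) atTop (𝓝 0) := by
  have hd := hasDerivAt_exp_smul_const (𝕂 := ℝ) K (0 : ℝ)
  rw [hasDerivAt_iff_isLittleO_nhds_zero] at hd
  simp only [zero_add, zero_smul, NormedSpace.exp_zero, one_mul] at hd
  have h0 : Tendsto (fun m : ℕ => c / (m : ℝ)) atTop (𝓝 0) := tendsto_const_div_atTop_nhds_zero_nat c
  have h1 := (hd.comp_tendsto h0).norm_norm
  have h2 : (fun m : ℕ => ‖c / (m : ℝ)‖) =O[atTop] fun m : ℕ => (m : ℝ)⁻¹ := by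
    refine Asymptotics.IsBigO.of_bound ‖c‖ (Eventually.of_forall fun m => ?_)
    simp [div_eq_mul_inv]
  have h3 := h1.trans_isBigO h2
  have h4 := h3.tendsto_div_nhds_zero
  refine h4.congr fun m => ?_
  simp only [Function.comp]
  rw [div_inv_eq_mul, mul_comm]
  rfl

/-- Comes from `‖1 + hK‖ ≤ 1 + h‖K‖ ≤ e^{h‖K‖}`. It serves as a growth factor whose `m`-th power
stays bounded when `h = c/m`. -/
lemma norm_exp_smul_le (K : Matrix (Fin d) (Fin d) ℝ) {h : ℝ} (hh : 0 ≤ h) :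
    ‖NormedSpace.exp (h • K)‖ ≤
      Real.exp (h * ‖K‖) + ‖NormedSpace.exp (h • K) - 1 - h • K‖ := by
  have h1 : ‖(1 : Matrix (Fin d) (Fin d) ℝ)‖ ≤ 1 := by
    rw [← Matrix.diagonal_one, Matrix.linfty_opNorm_diagonal]
    exact (pi_norm_le_iff_of_nonneg zero_le_one).2 fun i => by simp
  have h2 : NormedSpace.exp (h • K) =
      (NormedSpace.exp (h • K) - 1 - h • K) + (1 + h • K) := by abel
  have h3 := Real.add_one_le_exp (h * ‖K‖)
  have h4 : ‖h • K‖ = h * ‖K‖ := by rw [norm_smul, Real.norm_of_nonneg hh]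
  calc ‖NormedSpace.exp (h • K)‖ ≤ ‖NormedSpace.exp (h • K) - 1 - h • K‖ + ‖1 + h • K‖ := by
        conv_lhs => rw [h2]
        exact norm_add_le _ _
    _ ≤ _ := by
        have := norm_add_le (1 : Matrix (Fin d) (Fin d) ℝ) (h • K)
        linarith

/-- A function whose increments agree with those of the linear equation `φ' = K φ` up to an error
that vanishes along uniform partitions is a solution of it. -/
lemma eq_exp_mulVec_of_increment {φ : ℝ≥0 → Fin d → ℝ} (K : Matrix (Fin d) (Fin d) ℝ)
    {C B : ℝ} {ε : ℝ≥0 → ℝ≥0 → ℝ} {s t : ℝ≥0} (hst : s ≤ t)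
    (hB : ∀ a, ‖φ a‖ ≤ B)
    (h : ∀ a b, s ≤ a → a ≤ b → b ≤ t →
      ‖φ b - φ a - ((b : ℝ) - a) • (K *ᵥ φ a)‖ ≤ C * ((b : ℝ) - a) ^ 2 + ε a b)
    (hε : Tendsto (fun m : ℕ => ∑ k ∈ Finset.range m,
      ε (gridPoint s t m k) (gridPoint s t m (k + 1))) atTop (𝓝 0)) :
    φ t = NormedSpace.exp (((t : ℝ) - s) • K) *ᵥ φ s := by
  set c : ℝ := (t : ℝ) - s with hc
  have hc0 : 0 ≤ c := sub_nonneg.2 (by exact_mod_cast hst)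
  let ρ : ℕ → ℝ := fun m => ‖NormedSpace.exp ((c / m) • K) - 1 - (c / m) • K‖
  -- The local error of step `k`: the two assumed errors, plus the cost `ρ m * B` of replacing `1 +
  -- hK` by `exp (hK)`.
  let δ : ℕ → ℕ → ℝ := fun m k => C * (c / m) ^ 2 +
    ε (gridPoint s t m k) (gridPoint s t m (k + 1)) + ρ m * B
  have hmem : ∀ m k, k < m → s ≤ gridPoint s t m k ∧ gridPoint s t m (k + 1) ≤ t := by
    intro m k hk
    constructor
    · exact le_self_add
    · have hm : m ≠ 0 := by omega
      calc gridPoint s t m (k + 1) ≤ gridPoint s t m m := gridPoint_mono _ _ _ hk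
        _ = t := gridPoint_last hst hm
  have hstep : ∀ m k, k < m → ‖φ (gridPoint s t m (k + 1)) -
      NormedSpace.exp ((c / m) • K) *ᵥ φ (gridPoint s t m k)‖ ≤ δ m k := by
    intro m k hk
    have h1 := h _ _ (hmem m k hk).1 (gridPoint_mono s t m (Nat.le_succ k)) (hmem m k hk).2
    rw [coe_gridPoint_succ_sub hst] at h1
    set a := gridPoint s t m k
    set b := gridPoint s t m (k + 1)
    have h2 : φ b - NormedSpace.exp ((c / m) • K) *ᵥ φ a =
        (φ b - φ a - (c / m) • (K *ᵥ φ a)) -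
          (NormedSpace.exp ((c / m) • K) - 1 - (c / m) • K) *ᵥ φ a := by
      rw [Matrix.sub_mulVec, Matrix.sub_mulVec, Matrix.smul_mulVec, Matrix.one_mulVec]
      abel
    have h3 := Matrix.linfty_opNorm_mulVec
      (NormedSpace.exp ((c / m) • K) - 1 - (c / m) • K) (φ a)
    have h4 : ρ m * ‖φ a‖ ≤ ρ m * B := mul_le_mul_of_nonneg_left (hB a) (norm_nonneg _)
    rw [h2]
    refine (norm_sub_le _ _).trans ?_
    exact add_le_add h1 (h3.trans h4)
  have hδ0 : ∀ m k, k < m → 0 ≤ δ m k := fun m k hk => (norm_nonneg _).trans (hstep m k hk)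
  -- Discrete Grönwall: local errors add up, each amplified at most by the growth factor of the
  -- later steps.
  have hind : ∀ m k, k ≤ m → ‖φ (gridPoint s t m k) -
      NormedSpace.exp ((k : ℝ) • (c / m) • K) *ᵥ φ s‖ ≤
        (Real.exp (c / m * ‖K‖) + ρ m) ^ k * ∑ j ∈ Finset.range k, δ m j := by
    intro m k
    induction k with
    | zero => intro _; simp
    | succ k ih =>
      intro hk
      have ih := ih (by omega)
      have hE : NormedSpace.exp (((k + 1 : ℕ) : ℝ) • (c / m) • K) =
          NormedSpace.exp ((c / m) • K) * NormedSpace.exp ((k : ℝ) • (c / m) • K) := by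
        rw [← Matrix.exp_add_of_commute _ _ ((Commute.refl ((c / m) • K)).smul_right (k : ℝ))]
        congr 1
        push_cast
        rw [add_smul, one_smul, add_comm]
      have h2 : φ (gridPoint s t m (k + 1)) -
          NormedSpace.exp (((k + 1 : ℕ) : ℝ) • (c / m) • K) *ᵥ φ s =
          (φ (gridPoint s t m (k + 1)) -
            NormedSpace.exp ((c / m) • K) *ᵥ φ (gridPoint s t m k)) +
          NormedSpace.exp ((c / m) • K) *ᵥ (φ (gridPoint s t m k) -
            NormedSpace.exp ((k : ℝ) • (c / m) • K) *ᵥ φ s) := by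
        rw [hE, Matrix.mulVec_sub, Matrix.mulVec_mulVec]
        abel
      have hE1 : ‖NormedSpace.exp ((c / m) • K)‖ ≤ Real.exp (c / m * ‖K‖) + ρ m :=
        norm_exp_smul_le K (by positivity)
      have hr1 : 1 ≤ Real.exp (c / m * ‖K‖) + ρ m :=
        le_add_of_le_of_nonneg (Real.one_le_exp (by positivity)) (norm_nonneg _)
      set r := Real.exp (c / m * ‖K‖) + ρ m with hr
      rw [h2, Finset.sum_range_succ, mul_add]
      refine (norm_add_le _ _).trans ?_
      rw [add_comm]
      refine add_le_add ?_ ?_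
      · refine (Matrix.linfty_opNorm_mulVec _ _).trans ?_
        rw [pow_succ', mul_assoc]
        exact mul_le_mul hE1 ih (norm_nonneg _) (by linarith)
      · exact (hstep m k (by omega)).trans
          (le_mul_of_one_le_left (hδ0 m k (by omega)) (one_le_pow₀ hr1))
  have hρ := tendsto_mul_norm_exp_sub K c
  have hsum : Tendsto (fun m : ℕ => ∑ j ∈ Finset.range m, δ m j) atTop (𝓝 0) := by
    have h1 : Tendsto (fun m : ℕ => C * c * (c / (m : ℝ)) +
        ∑ k ∈ Finset.range m, ε (gridPoint s t m k) (gridPoint s t m (k + 1)) +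
          (m : ℝ) * ρ m * B) atTop (𝓝 (C * c * 0 + 0 + 0 * B)) :=
      (((tendsto_const_div_atTop_nhds_zero_nat c).const_mul _).add hε).add (hρ.mul_const B)
    simp only [mul_zero, zero_mul, add_zero] at h1
    refine h1.congr' ?_
    filter_upwards [eventually_ne_atTop 0] with m hm
    have hm' : (m : ℝ) ≠ 0 := by exact_mod_cast hm
    simp only [δ, Finset.sum_add_distrib, Finset.sum_const, Finset.card_range, nsmul_eq_mul]
    field_simp
  have hbound : ∀ᶠ m : ℕ in atTop, ‖φ t - NormedSpace.exp (c • K) *ᵥ φ s‖ ≤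
      Real.exp (c * ‖K‖ + 1) * ∑ j ∈ Finset.range m, δ m j := by
    filter_upwards [eventually_ne_atTop 0, hρ.eventually (eventually_le_nhds zero_lt_one)]
      with m hm hρm
    have hm' : (m : ℝ) ≠ 0 := by exact_mod_cast hm
    have h1 := hind m m le_rfl
    rw [gridPoint_last hst hm, smul_smul, mul_div_cancel₀ _ hm'] at h1
    refine h1.trans ?_
    refine mul_le_mul_of_nonneg_right ?_
      (Finset.sum_nonneg fun j hj => hδ0 m j (Finset.mem_range.1 hj))
    -- The `m`-th power of the right side is `exp (c‖K‖ + m ρ m)`, and `m ρ m ≤ 1` eventually; hence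
    -- the constant `exp (c‖K‖ + 1)`.
    have h2 : Real.exp (c / m * ‖K‖) + ρ m ≤ Real.exp (c / m * ‖K‖ + ρ m) := by
      rw [Real.exp_add]
      have h3 := Real.add_one_le_exp (ρ m)
      have h4 : 1 ≤ Real.exp (c / m * ‖K‖) := Real.one_le_exp (by positivity)
      nlinarith [norm_nonneg (NormedSpace.exp ((c / m) • K) - 1 - (c / m) • K)]
    refine (pow_le_pow_left₀ (add_nonneg (Real.exp_nonneg _) (norm_nonneg _)) h2 m).trans ?_
    rw [← Real.exp_nat_mul]
    refine Real.exp_le_exp.2 ?_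
    rw [mul_add]
    refine add_le_add (le_of_eq ?_) hρm
    field_simp
  have hlim : Tendsto (fun m : ℕ => Real.exp (c * ‖K‖ + 1) * ∑ j ∈ Finset.range m, δ m j)
      atTop (𝓝 0) := by simpa using hsum.const_mul (Real.exp (c * ‖K‖ + 1))
  have := ge_of_tendsto hlim hbound
  exact sub_eq_zero.1 (norm_le_zero_iff.1 this)

end Euler

/-! ### Joint measurability of right-continuous processes, and π-systems. -/

variable {Ω : Type*} [mΩ : MeasurableSpace Ω] {n d : ℕ}

/-- The points `⌈r (m + 1)⌉ / (m + 1)` approximate `r` from the right. -/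
def gridAbove (m : ℕ) (r : ℝ≥0) : ℝ≥0 := (⌈r * (m + 1)⌉₊ : ℝ≥0) / (m + 1)

lemma le_gridAbove (m : ℕ) (r : ℝ≥0) : r ≤ gridAbove m r := by
  rw [gridAbove, le_div_iff₀ (by positivity)]
  exact Nat.le_ceil _

lemma tendsto_gridAbove (r : ℝ≥0) : Tendsto (fun m => gridAbove m r) atTop (𝓝[≥] r) := by
  refine tendsto_nhdsWithin_iff.2 ⟨?_, Eventually.of_forall fun m => le_gridAbove m r⟩
  have h1 : Tendsto (fun m : ℕ => r + 1 / ((m : ℝ≥0) + 1)) atTop (𝓝 (r + 0)) :=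
    tendsto_const_nhds.add tendsto_one_div_add_atTop_nhds_zero_nat
  rw [add_zero] at h1
  refine tendsto_of_tendsto_of_tendsto_of_le_of_le tendsto_const_nhds h1
    (fun m => le_gridAbove m r) fun m => ?_
  have h2 : (⌈r * ((m : ℝ≥0) + 1)⌉₊ : ℝ≥0) ≤ r * (m + 1) + 1 := (Nat.ceil_lt_add_one (by positivity)).le
  rw [gridAbove, div_le_iff₀ (by positivity), add_mul, one_div, inv_mul_cancel₀ (by positivity)]
  exact h2

/-- A right-continuous process, stopped at `t`, is jointly measurable with respect to any
`σ`-algebra that contains its past. -/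
lemma measurable_uncurry_of_rightContinuous {E : Type*} [TopologicalSpace E]
    [TopologicalSpace.PseudoMetrizableSpace E] [MeasurableSpace E] [BorelSpace E]
    {X : ℝ≥0 → Ω → E} (t : ℝ≥0) (hX : ∀ r ≤ t, Measurable (X r))
    (hrc : ∀ ω r, ContinuousWithinAt (fun r => X r ω) (Set.Ici r) r) :
    Measurable fun p : ℝ≥0 × Ω => X (min p.1 t) p.2 := by
  -- On a grid, time enters only through a natural number, so measurability in `ω` suffices.
  -- Stopping at `t` keeps every evaluation in the past, and right-continuity gives the limit.
  have hstep : ∀ k : ℕ, Measurable fun p : ℝ≥0 × Ω => X (min (gridAbove k p.1) t) p.2 := by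
    intro k
    have h1 : Measurable fun p : ℕ × Ω => X (min ((p.1 : ℝ≥0) / (k + 1)) t) p.2 :=
      measurable_from_prod_countable_right fun j =>
        hX (min ((j : ℝ≥0) / (k + 1)) t) (min_le_right _ _)
    have h2 : Measurable fun r : ℝ≥0 => ⌈r * ((k : ℝ≥0) + 1)⌉₊ :=
      Nat.measurable_ceil.comp (measurable_id.mul_const _)
    have h3 : Measurable fun p : ℝ≥0 × Ω => (⌈p.1 * ((k : ℝ≥0) + 1)⌉₊, p.2) :=
      (h2.comp measurable_fst).prodMk measurable_snd
    have h4 := h1.comp h3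
    simpa only [gridAbove, Function.comp_def] using h4
  refine measurable_of_tendsto_metrizable hstep (tendsto_pi_nhds.2 fun p => ?_)
  have h3 : Tendsto (fun k => min (gridAbove k p.1) t) atTop (𝓝[≥] (min p.1 t)) := by
    have h4 := tendsto_nhdsWithin_iff.1 (tendsto_gridAbove p.1)
    refine tendsto_nhdsWithin_iff.2 ⟨h4.1.min tendsto_const_nhds, Eventually.of_forall fun k => ?_⟩
    exact min_le_min_right _ (le_gridAbove k p.1)
  exact (hrc p.2 (min p.1 t)).tendsto.comp h3

lemma measurable_uncurry_path {E : Type*} [TopologicalSpace E]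
    [TopologicalSpace.PseudoMetrizableSpace E] [MeasurableSpace E] [BorelSpace E]
    {X : ℝ≥0 → Ω → E} (hX : ∀ r, Measurable (X r))
    (hrc : ∀ ω r, ContinuousWithinAt (fun r => X r ω) (Set.Ici r) r) :
    Measurable fun p : ℝ≥0 × Ω => X p.1 p.2 := by
  refine measurable_of_tendsto_metrizable
    (f := fun (N : ℕ) (p : ℝ≥0 × Ω) => X (min p.1 (N : ℝ≥0)) p.2)
    (fun N => measurable_uncurry_of_rightContinuous (N : ℝ≥0) (fun r _ => hX r) hrc)
    (tendsto_pi_nhds.2 fun p => ?_)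
  refine tendsto_const_nhds.congr' ?_
  obtain ⟨N, hN⟩ := exists_nat_ge p.1
  filter_upwards [eventually_ge_atTop N] with M hM
  have : p.1 ≤ (M : ℝ≥0) := hN.trans (by exact_mod_cast hM)
  rw [min_eq_left this]

/-- Integrals over the sets of a `σ`-algebra are determined by a generating `π`-system. -/
lemma setIntegral_eq_of_piSystem {μ : Measure Ω} {m : MeasurableSpace Ω} (hm : m ≤ mΩ)
    {S : Set (Set Ω)} (hgen : m = MeasurableSpace.generateFrom S) (hpi : IsPiSystem S)
    {f g : Ω → ℝ} (hf : Integrable f μ) (hg : Integrable g μ)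
    (huniv : ∫ ω, f ω ∂μ = ∫ ω, g ω ∂μ)
    (h : ∀ G ∈ S, ∫ ω in G, f ω ∂μ = ∫ ω in G, g ω ∂μ) (G : Set Ω) (hG : MeasurableSet[m] G) :
    ∫ ω in G, f ω ∂μ = ∫ ω in G, g ω ∂μ := by
  refine MeasurableSpace.induction_on_inter
    (C := fun G _ => ∫ ω in G, f ω ∂μ = ∫ ω in G, g ω ∂μ) hgen hpi ?_ h ?_ ?_ G hG
  · simp
  · intro t ht h1
    rw [setIntegral_compl (hm _ ht) hf, setIntegral_compl (hm _ ht) hg, h1, huniv]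
  · intro F hdis hF h1
    rw [integral_iUnion (fun i => hm _ (hF i)) hdis hf.integrableOn,
      integral_iUnion (fun i => hm _ (hF i)) hdis hg.integrableOn]
    exact tsum_congr h1

lemma integrable_of_abs_le {μ : Measure Ω} [IsFiniteMeasure μ] {f : Ω → ℝ} {C : ℝ}
    (hf : Measurable f) (h : ∀ ω, |f ω| ≤ C) : Integrable f μ :=
  Integrable.of_bound hf.aestronglyMeasurable C (Eventually.of_forall h)

/-! ### Paths in the set of basis vectors and their additive functionals. -/

section Paths

variable {X : ℝ≥0 → Ω → Fin d → ℝ}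

omit mΩ in
lemma path_zero_or_one (hb : ∀ t ω, ∃ k : Fin d, X t ω = Pi.single k 1) (t ω l) :
    X t ω l = 0 ∨ X t ω l = 1 := by
  obtain ⟨k, hk⟩ := hb t ω
  rw [hk, Pi.single_apply]
  split_ifs <;> simp

omit mΩ in
lemma abs_path_le_one (hb : ∀ t ω, ∃ k : Fin d, X t ω = Pi.single k 1) (t ω l) :
    |X t ω l| ≤ 1 := by
  rcases path_zero_or_one hb t ω l with h | h <;> simp [h]

omit mΩ in
lemma sum_path (hb : ∀ t ω, ∃ k : Fin d, X t ω = Pi.single k 1) (t ω) :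
    ∑ l, X t ω l = 1 := by
  obtain ⟨k, hk⟩ := hb t ω
  simp [hk, Pi.single_apply]

-- At a basis vector the scalar rate `vᵀX` acts on each coordinate of `X` as the diagonal matrix
-- `diag v`. This is where the killing term of the generator comes from.
omit mΩ in
lemma path_mul_dotProduct (hb : ∀ t ω, ∃ k : Fin d, X t ω = Pi.single k 1) (v : Fin d → ℝ)
    (t ω l) : X t ω l * (v ⬝ᵥ X t ω) = v l * X t ω l := by
  obtain ⟨k, hk⟩ := hb t ω
  rw [hk, dotProduct_single, Pi.single_apply]
  split_ifs with h <;> simp [h]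

omit mΩ in
lemma abs_dotProduct_path_le (hb : ∀ t ω, ∃ k : Fin d, X t ω = Pi.single k 1) (v : Fin d → ℝ)
    (t ω) : |v ⬝ᵥ X t ω| ≤ ∑ i, |v i| := by
  obtain ⟨k, hk⟩ := hb t ω
  rw [hk, dotProduct_single, mul_one]
  exact Finset.single_le_sum (f := fun i => |v i|) (fun i _ => abs_nonneg _) (Finset.mem_univ k)

/-- The `ℓ¹`-distance between the states at two times. -/
def dev (X : ℝ≥0 → Ω → Fin d → ℝ) (a b : ℝ≥0) (ω : Ω) : ℝ := ∑ l, |X b ω l - X a ω l|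

omit mΩ in
lemma dev_nonneg (a b : ℝ≥0) (ω : Ω) : 0 ≤ dev X a b ω :=
  Finset.sum_nonneg fun _ _ => abs_nonneg _

omit mΩ in
lemma abs_sub_le_dev (a b : ℝ≥0) (ω : Ω) (l : Fin d) : |X b ω l - X a ω l| ≤ dev X a b ω :=
  Finset.single_le_sum (f := fun l => |X b ω l - X a ω l|) (fun _ _ => abs_nonneg _)
    (Finset.mem_univ l)

omit mΩ in
lemma dev_le_two (hb : ∀ t ω, ∃ k : Fin d, X t ω = Pi.single k 1) (a b : ℝ≥0) (ω : Ω) :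
    dev X a b ω ≤ 2 := by
  have h : ∀ t l, |X t ω l| = X t ω l := fun t l => by
    rcases path_zero_or_one hb t ω l with h | h <;> simp [h]
  calc dev X a b ω ≤ ∑ l, (|X b ω l| + |X a ω l|) :=
        Finset.sum_le_sum fun l _ => abs_sub _ _
    _ = 2 := by simp only [h, Finset.sum_add_distrib, sum_path hb]; norm_num

omit mΩ in
lemma abs_dotProduct_sub_le (v : Fin d → ℝ) (a b : ℝ≥0) (ω : Ω) :
    |v ⬝ᵥ X b ω - v ⬝ᵥ X a ω| ≤ (∑ i, |v i|) * dev X a b ω := by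
  rw [← dotProduct_sub, dotProduct, Finset.sum_mul]
  refine (Finset.abs_sum_le_sum_abs _ _).trans (Finset.sum_le_sum fun i _ => ?_)
  rw [abs_mul]
  exact mul_le_mul_of_nonneg_left (abs_sub_le_dev a b ω i) (abs_nonneg _)

omit mΩ in
lemma measurable_dotProduct {m : MeasurableSpace Ω} {t : ℝ≥0} (h : Measurable[m] (X t))
    (v : Fin d → ℝ) : Measurable[m] fun ω => v ⬝ᵥ X t ω := by
  have : Continuous fun x : Fin d → ℝ => v ⬝ᵥ x := by fun_prop
  exact this.measurable.comp h

/-- The additive functional `∫_0^t vᵀ X_r dr`. -/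
def addFun (v : Fin d → ℝ) (X : ℝ≥0 → Ω → Fin d → ℝ) (t : ℝ≥0) (ω : Ω) : ℝ :=
  ∫ r in (0 : ℝ)..(t : ℝ), v ⬝ᵥ X r.toNNReal ω

lemma measurable_path (hX : ∀ t, Measurable (X t))
    (hrc : ∀ ω r, ContinuousWithinAt (fun r => X r ω) (Set.Ici r) r) (ω : Ω) :
    Measurable fun r : ℝ => X r.toNNReal ω :=
  (measurable_uncurry_path hX hrc).comp
    (measurable_real_toNNReal.prodMk measurable_const : Measurable fun r : ℝ => (r.toNNReal, ω))

lemma intervalIntegrable_of_abs_le {f : ℝ → ℝ} (hf : Measurable f) {C : ℝ}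
    (h : ∀ r, |f r| ≤ C) (a b : ℝ) : IntervalIntegrable f volume a b := by
  rw [intervalIntegrable_iff]
  have : IsFiniteMeasure (volume.restrict (Set.uIoc a b)) := by unfold Set.uIoc; infer_instance
  exact Integrable.of_bound hf.aestronglyMeasurable C (Eventually.of_forall h)

variable (hb : ∀ t ω, ∃ k : Fin d, X t ω = Pi.single k 1) (hX : ∀ t, Measurable (X t))
  (hrc : ∀ ω r, ContinuousWithinAt (fun r => X r ω) (Set.Ici r) r)

include hb hX hrc

lemma intervalIntegrable_dotProduct (v : Fin d → ℝ) (ω : Ω) (a b : ℝ) :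
    IntervalIntegrable (fun r : ℝ => v ⬝ᵥ X r.toNNReal ω) volume a b := by
  have : Continuous fun x : Fin d → ℝ => v ⬝ᵥ x := by fun_prop
  exact intervalIntegrable_of_abs_le (this.measurable.comp (measurable_path hX hrc ω))
    (fun r => abs_dotProduct_path_le hb v _ ω) a b

lemma addFun_sub (v : Fin d → ℝ) (a b : ℝ≥0) (ω : Ω) :
    addFun v X b ω - addFun v X a ω = ∫ r in (a : ℝ)..(b : ℝ), v ⬝ᵥ X r.toNNReal ω :=
  intervalIntegral.integral_interval_sub_left
    (intervalIntegrable_dotProduct hb hX hrc v ω _ _)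
    (intervalIntegrable_dotProduct hb hX hrc v ω _ _)

lemma abs_addFun_sub_le (v : Fin d → ℝ) {a b : ℝ≥0} (hab : a ≤ b) (ω : Ω) :
    |addFun v X b ω - addFun v X a ω| ≤ (∑ i, |v i|) * ((b : ℝ) - a) := by
  rw [addFun_sub hb hX hrc]
  have h := intervalIntegral.norm_integral_le_of_norm_le_const (a := (a : ℝ)) (b := (b : ℝ))
    (f := fun r : ℝ => v ⬝ᵥ X r.toNNReal ω) (C := ∑ i, |v i|)
    fun r _ => abs_dotProduct_path_le hb v _ ω
  rwa [abs_of_nonneg (sub_nonneg.2 (NNReal.coe_le_coe.2 hab))] at h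

-- The path may be stopped at `t` inside the integral, so any `σ`-algebra containing the past up to
-- `t` will do: a member of a filtration, `pathSigma X` or the ambient one.
omit mΩ hb hX in
lemma measurable_addFun (v : Fin d → ℝ) {m : MeasurableSpace Ω} (t : ℝ≥0)
    (h : ∀ r ≤ t, Measurable[m] (X r)) : Measurable[m] (addFun v X t) := by
  have h1 := @measurable_uncurry_of_rightContinuous Ω m _ _ _ _ _ X t h hrc
  have h2 : @Measurable (ℝ × Ω) ℝ (@Prod.instMeasurableSpace _ _ _ m) _
      (fun p => v ⬝ᵥ X (min p.1.toNNReal t) p.2) := by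
    have hc : Continuous fun x : Fin d → ℝ => v ⬝ᵥ x := by fun_prop
    exact hc.measurable.comp (h1.comp
      (((measurable_real_toNNReal.comp (@measurable_fst _ _ _ m)).prodMk
        (@measurable_snd _ _ _ m))))
  have h3 := @StronglyMeasurable.integral_prod_left' ℝ Ω ℝ _ m (volume.restrict (Set.Ioc 0 (t : ℝ)))
    _ _ _ _ h2.stronglyMeasurable
  have h4 : addFun v X t = fun ω => ∫ r in Set.Ioc 0 (t : ℝ), v ⬝ᵥ X (min r.toNNReal t) ω := by
    ext ω
    rw [addFun, intervalIntegral.integral_of_le (NNReal.coe_nonneg t)]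
    refine setIntegral_congr_fun measurableSet_Ioc fun r hr => ?_
    have : r.toNNReal ≤ t := Real.toNNReal_le_iff_le_coe.2 hr.2
    simp only [min_eq_left this]
  rw [h4]
  exact h3.measurable

lemma intervalIntegrable_dev (a : ℝ≥0) (ω : Ω) (c e : ℝ) :
    IntervalIntegrable (fun r : ℝ => dev X a r.toNNReal ω) volume c e := by
  have h1 := measurable_path hX hrc ω
  refine intervalIntegrable_of_abs_le (C := 2) (f := fun r : ℝ => dev X a r.toNNReal ω) ?_
    (fun r => ?_) c e
  · exact Finset.measurable_sum _ fun l _ =>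
      (((measurable_pi_apply l).comp h1).sub measurable_const).abs
  · rw [abs_of_nonneg (dev_nonneg _ _ _)]
    exact dev_le_two hb _ _ _

lemma abs_addFun_sub_sub_le (v : Fin d → ℝ) {a b : ℝ≥0} (hab : a ≤ b) (ω : Ω) :
    |addFun v X b ω - addFun v X a ω - ((b : ℝ) - a) * (v ⬝ᵥ X a ω)| ≤
      (∑ i, |v i|) * ∫ r in (a : ℝ)..(b : ℝ), dev X a r.toNNReal ω := by
  have h0 : ((b : ℝ) - a) * (v ⬝ᵥ X a ω) = ∫ _ in (a : ℝ)..(b : ℝ), v ⬝ᵥ X a ω := by simp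
  rw [addFun_sub hb hX hrc, h0, ← intervalIntegral.integral_sub
    (intervalIntegrable_dotProduct hb hX hrc v ω _ _) intervalIntegrable_const,
    ← intervalIntegral.integral_const_mul, ← Real.norm_eq_abs]
  refine intervalIntegral.norm_integral_le_of_norm_le (NNReal.coe_le_coe.2 hab)
    (Eventually.of_forall fun r _ => abs_dotProduct_sub_le v _ _ ω)
    ((intervalIntegrable_dev hb hX hrc a ω _ _).const_mul _)

end Paths

/-! ### First- and second-order estimates from the martingale problem. -/

section Chain

/-- The weak form of the martingale problem of the generator `Q` along the filtration `𝔾`. -/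
def SolvesMartingaleProblem (μ : Measure Ω) (Q : Matrix (Fin d) (Fin d) ℝ)
    (X : ℝ≥0 → Ω → Fin d → ℝ) (𝔾 : Filtration ℝ≥0 mΩ) : Prop :=
  ∀ (l : Fin d) (a b : ℝ≥0) (W : Ω → ℝ), a ≤ b → Measurable[𝔾 a] W → (∀ ω, |W ω| ≤ 1) →
    ∫ ω, W ω * (X b ω l - X a ω l) ∂μ =
      ∫ ω, W ω * (addFun (Q l) X b ω - addFun (Q l) X a ω) ∂μ

/-- The sum of the absolute values of the entries of a matrix. -/
def entrySum (Q : Matrix (Fin d) (Fin d) ℝ) : ℝ := ∑ l, ∑ j, |Q l j|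

lemma entrySum_nonneg (Q : Matrix (Fin d) (Fin d) ℝ) : 0 ≤ entrySum Q :=
  Finset.sum_nonneg fun _ _ => Finset.sum_nonneg fun _ _ => abs_nonneg _

lemma row_sum_le_entrySum (Q : Matrix (Fin d) (Fin d) ℝ) (l : Fin d) :
    ∑ j, |Q l j| ≤ entrySum Q :=
  Finset.single_le_sum (f := fun l => ∑ j, |Q l j|)
    (fun _ _ => Finset.sum_nonneg fun _ _ => abs_nonneg _) (Finset.mem_univ l)

variable {X : ℝ≥0 → Ω → Fin d → ℝ} {μ : Measure Ω} [IsProbabilityMeasure μ]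
  {Q : Matrix (Fin d) (Fin d) ℝ} {𝔾 : Filtration ℝ≥0 mΩ}
  (hb : ∀ t ω, ∃ k : Fin d, X t ω = Pi.single k 1) (hX : ∀ t, Measurable (X t))
  (hrc : ∀ ω r, ContinuousWithinAt (fun r => X r ω) (Set.Ici r) r)

include hb hX hrc

/-- For values in `{0, 1}`, `|x - y| = (1 - 2y)(x - y)`. The weight `1 - 2 X_a` is known at time `a`
and bounded by 1, so the martingale problem replaces the increment by its drift, which is of order
`b - a`. -/
lemma integral_dev_le (hXa : ∀ t, Measurable[𝔾 t] (X t))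
    (hQ : SolvesMartingaleProblem μ Q X 𝔾) {a b : ℝ≥0} (hab : a ≤ b) :
    ∫ ω, dev X a b ω ∂μ ≤ entrySum Q * ((b : ℝ) - a) := by
  have hXl : ∀ t l, Measurable fun ω => X t ω l := fun t l => (measurable_pi_apply l).comp (hX t)
  have hba : 0 ≤ (b : ℝ) - a := sub_nonneg.2 (NNReal.coe_le_coe.2 hab)
  have hint : ∀ l, Integrable (fun ω => |X b ω l - X a ω l|) μ := fun l =>
    integrable_of_abs_le (C := 2) ((hXl b l).sub (hXl a l)).abs fun ω => by
      rw [abs_abs]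
      exact (abs_sub_le_dev a b ω l).trans (dev_le_two hb a b ω)
  simp only [dev]
  rw [integral_finsetSum _ fun l _ => hint l, entrySum, Finset.sum_mul]
  refine Finset.sum_le_sum fun l _ => ?_
  let W : Ω → ℝ := fun ω => 1 - 2 * X a ω l
  have hW1 : ∀ ω, |W ω| ≤ 1 := fun ω => by
    rcases path_zero_or_one hb a ω l with h | h <;> (simp [W, h]; try norm_num)
  have hW : Measurable[𝔾 a] W :=
    measurable_const.sub (((measurable_pi_apply l).comp (hXa a)).const_mul 2)
  have h1 : ∀ ω, |X b ω l - X a ω l| = W ω * (X b ω l - X a ω l) := fun ω => by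
    rcases path_zero_or_one hb a ω l with h | h <;>
      rcases path_zero_or_one hb b ω l with h' | h' <;> (simp [W, h, h']; try norm_num)
  simp only [h1]
  rw [hQ l a b W hab hW hW1]
  have h2 := norm_integral_le_of_norm_le_const (μ := μ)
    (f := fun ω => W ω * (addFun (Q l) X b ω - addFun (Q l) X a ω))
    (C := (∑ i, |Q l i|) * ((b : ℝ) - a)) (Eventually.of_forall fun ω => by
      rw [norm_mul]
      have := mul_le_mul (hW1 ω) (abs_addFun_sub_le hb hX hrc (Q l) hab ω) (abs_nonneg _)
        zero_le_one
      rwa [one_mul] at this)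
  simp only [probReal_univ, mul_one] at h2
  exact (le_abs_self _).trans h2

lemma integrable_uncurry_dev (a : ℝ≥0) (c e : ℝ) :
    Integrable (Function.uncurry fun (r : ℝ) ω => dev X a r.toNNReal ω)
      ((volume.restrict (Set.uIoc c e)).prod μ) := by
  have h1 : Measurable fun p : ℝ × Ω => X p.1.toNNReal p.2 :=
    (measurable_uncurry_path hX hrc).comp
      ((measurable_real_toNNReal.comp measurable_fst).prodMk measurable_snd)
  have h2 : Measurable fun p : ℝ × Ω => X a p.2 := (hX a).comp measurable_snd
  have : IsFiniteMeasure (volume.restrict (Set.uIoc c e)) := by unfold Set.uIoc; infer_instance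
  refine Integrable.of_bound (C := 2) (Measurable.aestronglyMeasurable ?_)
    (Eventually.of_forall fun p => ?_)
  · have h3 : Measurable fun p : ℝ × Ω => ∑ l, |X p.1.toNNReal p.2 l - X a p.2 l| :=
      Finset.measurable_sum _ fun l _ =>
        (((measurable_pi_apply l).comp h1).sub ((measurable_pi_apply l).comp h2)).abs
    exact h3
  · change ‖dev X a p.1.toNNReal p.2‖ ≤ 2
    rw [Real.norm_of_nonneg (dev_nonneg _ _ _)]
    exact dev_le_two hb _ _ _

lemma integrable_intervalIntegral_dev (a b : ℝ≥0) (hab : a ≤ b) :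
    Integrable (fun ω => ∫ r in (a : ℝ)..(b : ℝ), dev X a r.toNNReal ω) μ := by
  have h := (integrable_uncurry_dev (μ := μ) hb hX hrc a a b).integral_prod_right
  simp only [intervalIntegral.integral_of_le (NNReal.coe_le_coe.2 hab)]
  rwa [Set.uIoc_of_le (NNReal.coe_le_coe.2 hab)] at h

/-- By Fubini, a deviation of expected order `r - a` is integrated over an interval of length `b -
a`, which gives second order. -/
lemma integral_intervalIntegral_dev_le (hXa : ∀ t, Measurable[𝔾 t] (X t))
    (hQ : SolvesMartingaleProblem μ Q X 𝔾) {a b : ℝ≥0} (hab : a ≤ b) :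
    ∫ ω, (∫ r in (a : ℝ)..(b : ℝ), dev X a r.toNNReal ω) ∂μ ≤
      entrySum Q * ((b : ℝ) - a) ^ 2 := by
  have hab' : (a : ℝ) ≤ b := NNReal.coe_le_coe.2 hab
  rw [← intervalIntegral_integral_swap (integrable_uncurry_dev hb hX hrc a a b)]
  have h1 : ∀ r : ℝ, r ∈ Set.uIoc (a : ℝ) b →
      ‖∫ ω, dev X a r.toNNReal ω ∂μ‖ ≤ entrySum Q * ((b : ℝ) - a) := by
    intro r hr
    rw [Set.uIoc_of_le hab'] at hr
    have h2 : a ≤ r.toNNReal := NNReal.le_toNNReal_of_coe_le hr.1.le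
    have h3 := integral_dev_le hb hX hrc hXa hQ h2
    rw [Real.coe_toNNReal r (a.2.trans hr.1.le)] at h3
    rw [Real.norm_of_nonneg (integral_nonneg fun ω => dev_nonneg _ _ _)]
    exact h3.trans (mul_le_mul_of_nonneg_left (by linarith [hr.2]) (entrySum_nonneg Q))
  have h4 := intervalIntegral.norm_integral_le_of_norm_le_const h1
  rw [abs_of_nonneg (sub_nonneg.2 hab')] at h4
  calc _ ≤ _ := le_abs_self _
    _ ≤ _ := h4
    _ = _ := by ring

/-- The expected deviation of an additive functional from its linearization. -/
lemma integral_abs_addFun_sub_sub_le (hXa : ∀ t, Measurable[𝔾 t] (X t))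
    (hQ : SolvesMartingaleProblem μ Q X 𝔾) (v : Fin d → ℝ) {a b : ℝ≥0} (hab : a ≤ b) :
    ∫ ω, |addFun v X b ω - addFun v X a ω - ((b : ℝ) - a) * (v ⬝ᵥ X a ω)| ∂μ ≤
      (∑ i, |v i|) * entrySum Q * ((b : ℝ) - a) ^ 2 := by
  have hS : 0 ≤ ∑ i, |v i| := Finset.sum_nonneg fun _ _ => abs_nonneg _
  calc _ ≤ ∫ ω, (∑ i, |v i|) * (∫ r in (a : ℝ)..(b : ℝ), dev X a r.toNNReal ω) ∂μ := by
        refine integral_mono_of_nonneg (Eventually.of_forall fun ω => abs_nonneg _)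
          ((integrable_intervalIntegral_dev hb hX hrc a b hab).const_mul _)
          (Eventually.of_forall fun ω => abs_addFun_sub_sub_le hb hX hrc v hab ω)
    _ ≤ _ := by
        rw [integral_const_mul, mul_assoc]
        exact mul_le_mul_of_nonneg_left
          (integral_intervalIntegral_dev_le hb hX hrc hXa hQ hab) hS

omit [IsProbabilityMeasure μ] hb hX hrc in
lemma abs_integral_mul_le_of_abs_le_one {W f : Ω → ℝ} (hW1 : ∀ ω, |W ω| ≤ 1)
    (hf : Integrable f μ) : |∫ ω, W ω * f ω ∂μ| ≤ ∫ ω, |f ω| ∂μ := by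
  refine abs_integral_le_integral_abs.trans (integral_mono_of_nonneg
    (Eventually.of_forall fun ω => abs_nonneg _) hf.abs (Eventually.of_forall fun ω => ?_))
  change |W ω * f ω| ≤ |f ω|
  rw [abs_mul]
  exact mul_le_of_le_one_left (abs_nonneg _) (hW1 ω)

omit hb in
lemma measurable_addFun_ambient (v : Fin d → ℝ) (a : ℝ≥0) : Measurable (addFun v X a) :=
  measurable_addFun hrc v a fun r _ => hX r

lemma integrable_addFun_sub (v : Fin d → ℝ) {a b : ℝ≥0} (hab : a ≤ b) :
    Integrable (fun ω => addFun v X b ω - addFun v X a ω) μ :=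
  integrable_of_abs_le ((measurable_addFun_ambient hX hrc v b).sub
    (measurable_addFun_ambient hX hrc v a)) (abs_addFun_sub_le hb hX hrc v hab)

lemma integrable_addFun_sub_sub (v : Fin d → ℝ) {a b : ℝ≥0} (hab : a ≤ b) :
    Integrable (fun ω => addFun v X b ω - addFun v X a ω - ((b : ℝ) - a) * (v ⬝ᵥ X a ω)) μ :=
  (integrable_addFun_sub hb hX hrc v hab).sub
    ((integrable_of_abs_le (measurable_dotProduct (hX a) v)
      (abs_dotProduct_path_le hb v a)).const_mul _)

/-- The martingale problem exchanges the increment of `X` for `∫ Q X_r dr`; freezing the integrand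
at `X_a` then costs second order. -/
lemma abs_integral_chain_increment_le (hXa : ∀ t, Measurable[𝔾 t] (X t))
    (hQ : SolvesMartingaleProblem μ Q X 𝔾) (l : Fin d) {a b : ℝ≥0} (hab : a ≤ b) {W : Ω → ℝ}
    (hW : Measurable[𝔾 a] W) (hW1 : ∀ ω, |W ω| ≤ 1) :
    |∫ ω, W ω * (X b ω l - X a ω l - ((b : ℝ) - a) * (Q l ⬝ᵥ X a ω)) ∂μ| ≤
      entrySum Q * entrySum Q * ((b : ℝ) - a) ^ 2 := by
  have hWm : Measurable W := hW.mono (𝔾.le a) le_rfl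
  have hXl : ∀ t l, Measurable fun ω => X t ω l := fun t l => (measurable_pi_apply l).comp (hX t)
  have i1 : Integrable (fun ω => W ω * (X b ω l - X a ω l)) μ :=
    integrable_of_abs_le (C := 2) (hWm.mul ((hXl b l).sub (hXl a l))) fun ω => by
      rw [abs_mul]
      have := mul_le_mul (hW1 ω) ((abs_sub_le_dev a b ω l).trans (dev_le_two hb a b ω))
        (abs_nonneg _) zero_le_one
      simpa using this
  have i2 : Integrable (fun ω => W ω * (((b : ℝ) - a) * (Q l ⬝ᵥ X a ω))) μ :=
    (((integrable_of_abs_le (measurable_dotProduct (hX a) (Q l))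
      (abs_dotProduct_path_le hb (Q l) a)).const_mul _).bdd_mul
        hWm.aestronglyMeasurable (Eventually.of_forall hW1))
  have i3 : Integrable (fun ω => W ω * (addFun (Q l) X b ω - addFun (Q l) X a ω)) μ :=
    (integrable_addFun_sub hb hX hrc (Q l) hab).bdd_mul
      hWm.aestronglyMeasurable (Eventually.of_forall hW1)
  have h1 : ∫ ω, W ω * (X b ω l - X a ω l - ((b : ℝ) - a) * (Q l ⬝ᵥ X a ω)) ∂μ =
      ∫ ω, W ω * (addFun (Q l) X b ω - addFun (Q l) X a ω -
        ((b : ℝ) - a) * (Q l ⬝ᵥ X a ω)) ∂μ := by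
    simp only [mul_sub (W _)] at i1 i2 i3 ⊢
    simp only [← mul_sub (W _)] at i1 i2 i3 ⊢
    rw [show (fun ω => W ω * (X b ω l - X a ω l - ((b : ℝ) - a) * (Q l ⬝ᵥ X a ω))) =
      fun ω => W ω * (X b ω l - X a ω l) - W ω * (((b : ℝ) - a) * (Q l ⬝ᵥ X a ω)) from
        funext fun ω => by ring, integral_sub i1 i2, hQ l a b W hab hW hW1, ← integral_sub i3 i2]
    congr 1
    ext ω
    ring
  rw [h1]
  refine (abs_integral_mul_le_of_abs_le_one hW1
    (integrable_addFun_sub_sub hb hX hrc (Q l) hab)).trans ?_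
  refine (integral_abs_addFun_sub_sub_le hb hX hrc hXa hQ (Q l) hab).trans ?_
  exact mul_le_mul_of_nonneg_right (mul_le_mul_of_nonneg_right (row_sum_le_entrySum Q l)
    (entrySum_nonneg Q)) (sq_nonneg _)

end Chain

/-- Bounded measurable functions. -/
def BddMeas (f : Ω → ℝ) : Prop := Measurable f ∧ ∃ C, ∀ ω, |f ω| ≤ C

namespace BddMeas

variable {f g : Ω → ℝ}

lemma of_le {C : ℝ} (hf : Measurable f) (h : ∀ ω, |f ω| ≤ C) : BddMeas f := ⟨hf, C, h⟩

lemma const (c : ℝ) : BddMeas fun _ : Ω => c := ⟨measurable_const, |c|, fun _ => le_rfl⟩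

lemma add (hf : BddMeas f) (hg : BddMeas g) : BddMeas fun ω => f ω + g ω := by
  obtain ⟨C, hC⟩ := hf.2
  obtain ⟨D, hD⟩ := hg.2
  exact ⟨hf.1.add hg.1, C + D, fun ω => (abs_add_le _ _).trans (add_le_add (hC ω) (hD ω))⟩

lemma sub (hf : BddMeas f) (hg : BddMeas g) : BddMeas fun ω => f ω - g ω := by
  obtain ⟨C, hC⟩ := hf.2
  obtain ⟨D, hD⟩ := hg.2
  exact ⟨hf.1.sub hg.1, C + D, fun ω => (abs_sub _ _).trans (add_le_add (hC ω) (hD ω))⟩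

lemma mul (hf : BddMeas f) (hg : BddMeas g) : BddMeas fun ω => f ω * g ω := by
  obtain ⟨C, hC⟩ := hf.2
  obtain ⟨D, hD⟩ := hg.2
  refine ⟨hf.1.mul hg.1, C * D, fun ω => ?_⟩
  rw [abs_mul]
  exact mul_le_mul (hC ω) (hD ω) (abs_nonneg _) ((abs_nonneg _).trans (hC ω))

lemma abs (hf : BddMeas f) : BddMeas fun ω => |f ω| := by
  obtain ⟨C, hC⟩ := hf.2
  exact ⟨hf.1.abs, C, fun ω => by rw [abs_abs]; exact hC ω⟩

lemma sum {ι : Type*} {S : Finset ι} {F : ι → Ω → ℝ} (h : ∀ i ∈ S, BddMeas (F i)) :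
    BddMeas fun ω => ∑ i ∈ S, F i ω := by
  classical
  induction S using Finset.induction_on with
  | empty => simpa using const (Ω := Ω) 0
  | insert a S ha ih =>
    simp only [Finset.sum_insert ha]
    exact (h a (by simp)).add (ih fun i hi => h i (by simp [hi]))

lemma prod {ι : Type*} {S : Finset ι} {F : ι → Ω → ℝ} (h : ∀ i ∈ S, BddMeas (F i)) :
    BddMeas fun ω => ∏ i ∈ S, F i ω := by
  classical
  induction S using Finset.induction_on with
  | empty => simpa using const (Ω := Ω) 1
  | insert a S ha ih =>
    simp only [Finset.prod_insert ha]
    exact (h a (by simp)).mul (ih fun i hi => h i (by simp [hi]))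

lemma integrable {μ : Measure Ω} [IsFiniteMeasure μ] (hf : BddMeas f) : Integrable f μ := by
  obtain ⟨C, hC⟩ := hf.2
  exact integrable_of_abs_le hf.1 hC

end BddMeas

/-! ### Product rule and Feynman-Kac formula. -/

section FeynmanKac

variable {X : ℝ≥0 → Ω → Fin d → ℝ} {μ : Measure Ω} [IsProbabilityMeasure μ]
  {Q : Matrix (Fin d) (Fin d) ℝ} {𝔾 : Filtration ℝ≥0 mΩ}
  (hb : ∀ t ω, ∃ k : Fin d, X t ω = Pi.single k 1) (hX : ∀ t, Measurable (X t))
  (hrc : ∀ ω r, ContinuousWithinAt (fun r => X r ω) (Set.Ici r) r)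

include hb hX

lemma bddMeas_path (t : ℝ≥0) (l : Fin d) : BddMeas fun ω => X t ω l :=
  .of_le ((measurable_pi_apply l).comp (hX t)) fun ω => abs_path_le_one hb t ω l

lemma bddMeas_dotProduct (v : Fin d → ℝ) (t : ℝ≥0) : BddMeas fun ω => v ⬝ᵥ X t ω :=
  .of_le (measurable_dotProduct (hX t) v) (abs_dotProduct_path_le hb v t)

lemma bddMeas_dev (a b : ℝ≥0) : BddMeas (dev X a b) :=
  .sum fun l _ => ((bddMeas_path hb hX b l).sub (bddMeas_path hb hX a l)).abs

include hrc

/-- If the process `V` decreases at rate `vᵀ X V` and does not move together with `X`, then `X V`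
has the generator `Q - diag v`. -/
lemma integral_path_mul_eq_exp (hXa : ∀ t, Measurable[𝔾 t] (X t))
    (hQ : SolvesMartingaleProblem μ Q X 𝔾) {v : Fin d → ℝ} {V : ℝ≥0 → Ω → ℝ} {C : ℝ} (hC : 0 ≤ C)
    (hVm : ∀ a, Measurable[𝔾 a] (V a)) (hV1 : ∀ a ω, |V a ω| ≤ 1)
    (hV : ∀ (a b : ℝ≥0) (W : Ω → ℝ), a ≤ b → Measurable[𝔾 a] W → (∀ ω, |W ω| ≤ 1) →
      |∫ ω, W ω * (V b ω - V a ω + ((b : ℝ) - a) * ((v ⬝ᵥ X a ω) * V a ω)) ∂μ| ≤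
        C * ((b : ℝ) - a) ^ 2)
    {s t : ℝ≥0} (hst : s ≤ t)
    (hvar : Tendsto (fun m : ℕ => ∑ k ∈ Finset.range m,
      ∫ ω, dev X (gridPoint s t m k) (gridPoint s t m (k + 1)) ω *
        |V (gridPoint s t m (k + 1)) ω - V (gridPoint s t m k) ω| ∂μ) atTop (𝓝 0))
    {W : Ω → ℝ} (hW : Measurable[𝔾 s] W) (hW1 : ∀ ω, |W ω| ≤ 1) :
    (fun l => ∫ ω, W ω * (X t ω l * V t ω) ∂μ) =
      NormedSpace.exp (((t : ℝ) - s) • (Q - Matrix.diagonal v)) *ᵥ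
        fun l => ∫ ω, W ω * (X s ω l * V s ω) ∂μ := by
  have bW : BddMeas W := .of_le (hW.mono (𝔾.le s) le_rfl) hW1
  have bV : ∀ a, BddMeas (V a) := fun a => .of_le ((hVm a).mono (𝔾.le a) le_rfl) (hV1 a)
  have bX := bddMeas_path hb hX
  have bD := bddMeas_dotProduct hb hX
  have mul1 : ∀ x y : ℝ, |x| ≤ 1 → |y| ≤ 1 → |x * y| ≤ 1 := fun x y hx hy => by
    rw [abs_mul]
    exact mul_le_one₀ hx (abs_nonneg _) hy
  refine eq_exp_mulVec_of_increment (φ := fun a l => ∫ ω, W ω * (X a ω l * V a ω) ∂μ)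
    (Q - Matrix.diagonal v) (B := 1) (C := entrySum Q * entrySum Q + C)
    (ε := fun a b => ∫ ω, dev X a b ω * |V b ω - V a ω| ∂μ) hst (fun a => ?_)
    (fun a b hsa hab hbt => ?_) hvar
  · refine (pi_norm_le_iff_of_nonneg zero_le_one).2 fun l => ?_
    have h := norm_integral_le_of_norm_le_const (μ := μ)
      (f := fun ω => W ω * (X a ω l * V a ω)) (C := 1) (Eventually.of_forall fun ω =>
        mul1 _ _ (hW1 ω) (mul1 _ _ (abs_path_le_one hb a ω l) (hV1 a ω)))
    simpa using h
  · have hWa : Measurable[𝔾 a] W := hW.mono (𝔾.mono hsa) le_rfl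
    have hε0 : 0 ≤ ∫ ω, dev X a b ω * |V b ω - V a ω| ∂μ :=
      integral_nonneg fun ω => mul_nonneg (dev_nonneg _ _ _) (abs_nonneg _)
    have hC0 := mul_self_nonneg (entrySum Q)
    refine (pi_norm_le_iff_of_nonneg (by positivity)).2 fun l => ?_
    have h1 := abs_integral_chain_increment_le hb hX hrc hXa hQ l hab
      (W := fun ω => W ω * V a ω) (hWa.mul (hVm a)) fun ω => mul1 _ _ (hW1 ω) (hV1 a ω)
    have h2 := hV a b (fun ω => W ω * X a ω l) hab
      (hWa.mul ((measurable_pi_apply l).comp (hXa a)))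
      fun ω => mul1 _ _ (hW1 ω) (abs_path_le_one hb a ω l)
    -- The covariation term. It is not of second order on each interval in general, so it goes into
    -- `ε`, whose sums vanish by `hvar`.
    have h3 : |∫ ω, W ω * ((X b ω l - X a ω l) * (V b ω - V a ω)) ∂μ| ≤
        ∫ ω, dev X a b ω * |V b ω - V a ω| ∂μ := by
      refine (abs_integral_mul_le_of_abs_le_one hW1
        (((bX b l).sub (bX a l)).mul ((bV b).sub (bV a))).integrable).trans ?_
      refine integral_mono (((bX b l).sub (bX a l)).mul ((bV b).sub (bV a))).abs.integrable
        ((bddMeas_dev hb hX a b).mul ((bV b).sub (bV a)).abs).integrable fun ω => ?_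
      simp only [abs_mul]
      exact mul_le_mul_of_nonneg_right (abs_sub_le_dev a b ω l) (abs_nonneg _)
    have hK : ((Q - Matrix.diagonal v) *ᵥ fun l => ∫ ω, W ω * (X a ω l * V a ω) ∂μ) l =
        ∫ ω, W ω * ((Q l ⬝ᵥ X a ω - v l * X a ω l) * V a ω) ∂μ := by
      rw [Matrix.sub_mulVec, Pi.sub_apply, Matrix.mulVec_diagonal, Matrix.mulVec, dotProduct]
      simp only [← integral_const_mul]
      rw [← integral_finsetSum _ fun j _ =>
        ((BddMeas.const (Q l j)).mul (bW.mul ((bX a j).mul (bV a)))).integrable,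
        ← integral_sub (BddMeas.sum fun j _ =>
          (BddMeas.const (Q l j)).mul (bW.mul ((bX a j).mul (bV a)))).integrable
          ((BddMeas.const (v l)).mul (bW.mul ((bX a l).mul (bV a)))).integrable]
      congr 1
      ext ω
      simp only [dotProduct, sub_mul, mul_sub, Finset.sum_mul, Finset.mul_sum]
      congr 1
      · exact Finset.sum_congr rfl fun j _ => by ring
      · ring
    -- The product rule `Δ(XV) = V_a ΔX + X_a ΔV + ΔX ΔV`, with both drifts subtracted. The drifts
    -- combine to `Q - diag v` by `path_mul_dotProduct`.
    have hdec : (∫ ω, W ω * (X b ω l * V b ω) ∂μ) - (∫ ω, W ω * (X a ω l * V a ω) ∂μ) -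
        ((b : ℝ) - a) * ((Q - Matrix.diagonal v) *ᵥ
          fun l => ∫ ω, W ω * (X a ω l * V a ω) ∂μ) l =
        (∫ ω, (W ω * V a ω) * (X b ω l - X a ω l - ((b : ℝ) - a) * (Q l ⬝ᵥ X a ω)) ∂μ) +
        (∫ ω, (W ω * X a ω l) *
          (V b ω - V a ω + ((b : ℝ) - a) * ((v ⬝ᵥ X a ω) * V a ω)) ∂μ) +
        ∫ ω, W ω * ((X b ω l - X a ω l) * (V b ω - V a ω)) ∂μ := by
      rw [hK, ← integral_const_mul]
      have j1 := bW.mul ((bX b l).mul (bV b))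
      have j2 := bW.mul ((bX a l).mul (bV a))
      have j3 := (BddMeas.const ((b : ℝ) - a)).mul
        (bW.mul ((((bD (Q l) a)).sub ((BddMeas.const (v l)).mul (bX a l))).mul (bV a)))
      have j4 := (bW.mul (bV a)).mul (((bX b l).sub (bX a l)).sub
        ((BddMeas.const ((b : ℝ) - a)).mul (bD (Q l) a)))
      have j5 := (bW.mul (bX a l)).mul (((bV b).sub (bV a)).add
        ((BddMeas.const ((b : ℝ) - a)).mul ((bD v a).mul (bV a))))
      have j6 := bW.mul (((bX b l).sub (bX a l)).mul ((bV b).sub (bV a)))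
      rw [← integral_sub j1.integrable j2.integrable,
        ← integral_sub (j1.sub j2).integrable j3.integrable,
        ← integral_add j4.integrable j5.integrable,
        ← integral_add (j4.add j5).integrable j6.integrable]
      congr 1
      ext ω
      linear_combination (-(W ω * ((b : ℝ) - a) * V a ω)) * path_mul_dotProduct hb v a ω l
    change |(∫ ω, W ω * (X b ω l * V b ω) ∂μ) - (∫ ω, W ω * (X a ω l * V a ω) ∂μ) -
        ((b : ℝ) - a) * ((Q - Matrix.diagonal v) *ᵥ
          fun l => ∫ ω, W ω * (X a ω l * V a ω) ∂μ) l| ≤ _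
    rw [hdec, add_mul]
    exact (abs_add_le _ _).trans (add_le_add ((abs_add_le _ _).trans (add_le_add h1 h2)) h3)

omit mΩ hX hrc in
lemma addFun_nonneg {v : Fin d → ℝ} (hv : ∀ i, 0 ≤ v i) (ω : Ω) (t : ℝ≥0) :
    0 ≤ addFun v X t ω := by
  refine intervalIntegral.integral_nonneg t.2 fun r _ => ?_
  obtain ⟨k, hk⟩ := hb r.toNNReal ω
  rw [hk, dotProduct_single, mul_one]
  exact hv k

lemma addFun_sub_nonneg {v : Fin d → ℝ} (hv : ∀ i, 0 ≤ v i) (ω : Ω) {a b : ℝ≥0} (hab : a ≤ b) :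
    0 ≤ addFun v X b ω - addFun v X a ω := by
  rw [addFun_sub hb hX hrc]
  refine intervalIntegral.integral_nonneg (NNReal.coe_le_coe.2 hab) fun r _ => ?_
  obtain ⟨k, hk⟩ := hb r.toNNReal ω
  rw [hk, dotProduct_single, mul_one]
  exact hv k

omit hb hX hrc [IsProbabilityMeasure μ] mΩ in
lemma exp_neg_sub_one_add_le_sq {x : ℝ} (hx : 0 ≤ x) : |Real.exp (-x) - 1 + x| ≤ x ^ 2 := by
  have h1 := Real.add_one_le_exp (-x)
  rw [abs_of_nonneg (by linarith)]
  have h2 : Real.exp (-x) ≤ 1 / (1 + x) := by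
    rw [Real.exp_neg, ← one_div]
    exact one_div_le_one_div_of_le (by linarith) (by linarith [Real.add_one_le_exp x])
  have h3 : 1 / (1 + x) - 1 + x ≤ x ^ 2 := by
    have : 0 < 1 + x := by linarith
    rw [show 1 / (1 + x) - 1 + x = x ^ 2 / (1 + x) by field_simp; ring]
    exact div_le_self (sq_nonneg x) (by linarith)
  linarith

/-- The Feynman-Kac formula for the chain, tested against the past. -/
lemma integral_path_mul_exp_addFun (hXa : ∀ t, Measurable[𝔾 t] (X t))
    (hQ : SolvesMartingaleProblem μ Q X 𝔾) {v : Fin d → ℝ} (hv : ∀ i, 0 ≤ v i)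
    {s t : ℝ≥0} (hst : s ≤ t) {W : Ω → ℝ} (hW : Measurable[𝔾 s] W) (hW1 : ∀ ω, |W ω| ≤ 1) :
    (fun l => ∫ ω, W ω * (X t ω l * Real.exp (-addFun v X t ω)) ∂μ) =
      NormedSpace.exp (((t : ℝ) - s) • (Q - Matrix.diagonal v)) *ᵥ
        fun l => ∫ ω, W ω * (X s ω l * Real.exp (-addFun v X s ω)) ∂μ := by
  set S : ℝ := ∑ i, |v i| with hS
  have hS0 : 0 ≤ S := Finset.sum_nonneg fun _ _ => abs_nonneg _
  set q := entrySum Q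
  have hq0 : 0 ≤ q := entrySum_nonneg Q
  set V : ℝ≥0 → Ω → ℝ := fun a ω => Real.exp (-addFun v X a ω) with hVdef
  have hVm : ∀ a, Measurable[𝔾 a] (V a) := fun a => Real.measurable_exp.comp
    (measurable_addFun hrc v a fun r hr => (hXa r).mono (𝔾.mono hr) le_rfl).neg
  have hV1 : ∀ a ω, |V a ω| ≤ 1 := fun a ω => by
    rw [abs_of_pos (Real.exp_pos _), Real.exp_le_one_iff]
    linarith [addFun_nonneg hb hv ω a]
  have bV : ∀ a, BddMeas (V a) := fun a => .of_le ((hVm a).mono (𝔾.le a) le_rfl) (hV1 a)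
  have hfac : ∀ a b ω, V b ω = V a ω * Real.exp (-(addFun v X b ω - addFun v X a ω)) := by
    intro a b ω
    simp only [V]
    rw [← Real.exp_add]
    ring_nf
  -- `S ^ 2` bounds the second-order Taylor remainder of the exponential, `S * q` the cost of
  -- freezing `vᵀX` at time `a`.
  refine integral_path_mul_eq_exp hb hX hrc hXa hQ (C := S ^ 2 + S * q) (by positivity)
    hVm hV1 (fun a b W hab hW hW1 => ?_) hst ?_ hW hW1
  · have bD := bddMeas_dotProduct hb hX v a
    have hint := (((bV b).sub (bV a)).add
      ((BddMeas.const ((b : ℝ) - a)).mul (bD.mul (bV a)))).integrable (μ := μ)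
    have hint2 := (integrable_addFun_sub_sub (μ := μ) hb hX hrc v hab).abs
    calc _ ≤ ∫ ω, |V b ω - V a ω + ((b : ℝ) - a) * ((v ⬝ᵥ X a ω) * V a ω)| ∂μ :=
          abs_integral_mul_le_of_abs_le_one hW1 hint
      _ ≤ ∫ ω, ((S * ((b : ℝ) - a)) ^ 2 +
            |addFun v X b ω - addFun v X a ω - ((b : ℝ) - a) * (v ⬝ᵥ X a ω)|) ∂μ := by
          refine integral_mono hint.abs ((integrable_const _).add hint2) fun ω => ?_
          set x := addFun v X b ω - addFun v X a ω with hx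
          have hx0 : 0 ≤ x := addFun_sub_nonneg hb hX hrc hv ω hab
          have hx1 : x ≤ S * ((b : ℝ) - a) :=
            (le_abs_self _).trans (abs_addFun_sub_le hb hX hrc v hab ω)
          have h1 : V b ω - V a ω + ((b : ℝ) - a) * ((v ⬝ᵥ X a ω) * V a ω) =
              V a ω * (Real.exp (-x) - 1 + x) + V a ω * -(x - ((b : ℝ) - a) * (v ⬝ᵥ X a ω)) := by
            rw [hfac a b ω]
            ring
          simp only [h1]
          refine (abs_add_le _ _).trans (add_le_add ?_ ?_)
          · rw [abs_mul]
            calc _ ≤ 1 * x ^ 2 := mul_le_mul (hV1 a ω) (exp_neg_sub_one_add_le_sq hx0)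
                  (abs_nonneg _) zero_le_one
              _ ≤ _ := by rw [one_mul]; exact pow_le_pow_left₀ hx0 hx1 2
          · rw [abs_mul, abs_neg]
            exact mul_le_of_le_one_left (abs_nonneg _) (hV1 a ω)
      _ = (S * ((b : ℝ) - a)) ^ 2 +
            ∫ ω, |addFun v X b ω - addFun v X a ω - ((b : ℝ) - a) * (v ⬝ᵥ X a ω)| ∂μ := by
          rw [integral_add (integrable_const _) hint2]
          simp
      _ ≤ _ := by
          have := integral_abs_addFun_sub_sub_le hb hX hrc hXa hQ v hab
          nlinarith
  -- Here `V` is Lipschitz in time, so the covariation term is itself of second order and its sum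
  -- over the partition is `O(1/m)`.
  · have hterm : ∀ a b, a ≤ b → ∫ ω, dev X a b ω * |V b ω - V a ω| ∂μ ≤
        q * S * ((b : ℝ) - a) ^ 2 := by
      intro a b hab
      have hba : 0 ≤ (b : ℝ) - a := sub_nonneg.2 (NNReal.coe_le_coe.2 hab)
      calc _ ≤ ∫ ω, dev X a b ω * (S * ((b : ℝ) - a)) ∂μ := by
            refine integral_mono ((bddMeas_dev hb hX a b).mul ((bV b).sub (bV a)).abs).integrable
              ((bddMeas_dev hb hX a b).mul (BddMeas.const _)).integrable fun ω =>
                mul_le_mul_of_nonneg_left ?_ (dev_nonneg _ _ _)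
            set x := addFun v X b ω - addFun v X a ω with hx
            have hx0 : 0 ≤ x := addFun_sub_nonneg hb hX hrc hv ω hab
            have hx1 : x ≤ S * ((b : ℝ) - a) :=
              (le_abs_self _).trans (abs_addFun_sub_le hb hX hrc v hab ω)
            rw [hfac a b ω, show V a ω * Real.exp (-x) - V a ω = V a ω * (Real.exp (-x) - 1) by
              ring, abs_mul]
            refine (mul_le_of_le_one_left (abs_nonneg _) (hV1 a ω)).trans ?_
            rw [abs_sub_comm, abs_of_nonneg
              (sub_nonneg.2 (Real.exp_le_one_iff.2 (neg_nonpos.2 hx0)))]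
            linarith [Real.add_one_le_exp (-x)]
        _ = (∫ ω, dev X a b ω ∂μ) * (S * ((b : ℝ) - a)) := integral_mul_const _ _
        _ ≤ q * ((b : ℝ) - a) * (S * ((b : ℝ) - a)) :=
            mul_le_mul_of_nonneg_right (integral_dev_le hb hX hrc hXa hQ hab) (by positivity)
        _ = _ := by ring
    have hlim : Tendsto (fun m : ℕ => q * S * ((t : ℝ) - s) * (((t : ℝ) - s) / m)) atTop (𝓝 0) := by
      simpa using (tendsto_const_div_atTop_nhds_zero_nat ((t : ℝ) - s)).const_mul
        (q * S * ((t : ℝ) - s))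
    refine squeeze_zero' (Eventually.of_forall fun m => Finset.sum_nonneg fun k _ =>
      integral_nonneg fun ω => mul_nonneg (dev_nonneg _ _ _) (abs_nonneg _)) ?_ hlim
    filter_upwards [eventually_ne_atTop 0] with m hm
    have hm' : (m : ℝ) ≠ 0 := by exact_mod_cast hm
    calc _ ≤ ∑ _k ∈ Finset.range m, q * S * (((t : ℝ) - s) / m) ^ 2 := by
          refine Finset.sum_le_sum fun k _ => ?_
          have := hterm _ _ (gridPoint_mono s t m (Nat.le_succ k))
          rwa [coe_gridPoint_succ_sub hst] at this
      _ = _ := by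
          rw [Finset.sum_const, Finset.card_range, nsmul_eq_mul]
          field_simp

end FeynmanKac

/-! ### The default indicator: vanishing covariation with the chain, and the survival evolution. -/

section Default

variable {X : ℝ≥0 → Ω → Fin d → ℝ} {τ : Fin n → Ω → ℝ≥0∞} {i : Fin n}

omit mΩ in
lemma defaultInd_zero_or_one (i : Fin n) (t : ℝ≥0) (ω : Ω) :
    defaultInd τ i t ω = 0 ∨ defaultInd τ i t ω = 1 := by
  unfold defaultInd
  split_ifs <;> simp

omit mΩ in
lemma defaultInd_mono (i : Fin n) {a b : ℝ≥0} (hab : a ≤ b) (ω : Ω) :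
    defaultInd τ i a ω ≤ defaultInd τ i b ω := by
  unfold defaultInd
  have : (a : ℝ≥0∞) ≤ b := ENNReal.coe_le_coe.2 hab
  split_ifs with h1 h2
  · rfl
  · exact absurd (h1.trans this) h2
  · exact zero_le_one
  · rfl

omit mΩ in
lemma abs_one_sub_defaultInd_le_one (i : Fin n) (t : ℝ≥0) (ω : Ω) :
    |1 - defaultInd τ i t ω| ≤ 1 := by
  rcases defaultInd_zero_or_one (τ := τ) i t ω with h | h <;> simp [h]

omit mΩ in
lemma dev_triangle (a b c : ℝ≥0) (ω : Ω) : dev X a b ω ≤ dev X c a ω + dev X c b ω := by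
  unfold dev
  rw [← Finset.sum_add_distrib]
  refine Finset.sum_le_sum fun l _ => ?_
  rw [abs_sub_comm (X a ω l)]
  have := abs_sub_le (X b ω l) (X c ω l) (X a ω l)
  linarith

omit mΩ in
/-- Without a common jump, the chain moves little across the default time. -/
lemma exists_dev_le_of_defaultInd_ne {ω : Ω}
    (hrc : ∀ r, ContinuousWithinAt (fun r => X r ω) (Set.Ici r) r)
    (hll : ∀ t, ∃ x, Tendsto (fun r => X r ω) (𝓝[<] t) (𝓝 x))
    (hj : ∀ t, jump (fun r => defaultInd τ i r ω) t • jump (fun r => X r ω) t = 0)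
    {η : ℝ} (hη : 0 < η) :
    ∃ δ > 0, ∀ a b : ℝ≥0, a ≤ b → (b : ℝ) - a < δ →
      defaultInd τ i a ω ≠ defaultInd τ i b ω → dev X a b ω ≤ η := by
  -- A default at time 0 or at infinity leaves the indicator constant on all of `[0, ∞)`. Otherwise
  -- `T > 0`, so that the left limits at `T` are genuine limits.
  by_cases hτ0 : τ i ω = 0
  · refine ⟨1, one_pos, fun a b _ _ hne => absurd ?_ hne⟩
    simp [defaultInd, hτ0]
  by_cases hτt : τ i ω = ⊤
  · refine ⟨1, one_pos, fun a b _ _ hne => absurd ?_ hne⟩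
    simp [defaultInd, hτt]
  obtain ⟨T, hT⟩ : ∃ T : ℝ≥0, (T : ℝ≥0∞) = τ i ω := ⟨_, ENNReal.coe_toNNReal hτt⟩
  have hT0 : 0 < T := pos_iff_ne_zero.2 fun h => hτ0 (by rw [← hT, h]; rfl)
  have hY : ∀ r : ℝ≥0, defaultInd τ i r ω = if T ≤ r then 1 else 0 := fun r => by
    simp [defaultInd, ← hT]
  have hbot : (𝓝[<] T).NeBot := nhdsLT_neBot_of_exists_lt ⟨0, hT0⟩
  have hYj : jump (fun r => defaultInd τ i r ω) T = 1 := by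
    have h1 : Tendsto (fun r => defaultInd τ i r ω) (𝓝[<] T) (𝓝 0) := by
      refine tendsto_const_nhds.congr' ?_
      filter_upwards [self_mem_nhdsWithin] with r hr
      rw [hY, if_neg (not_le.2 hr)]
    rw [jump, leftLim_eq_of_tendsto h1, hY, if_pos le_rfl, sub_zero]
  have hXj : jump (fun r => X r ω) T = 0 := by
    have := hj T
    rwa [hYj, one_smul] at this
  obtain ⟨x, hx⟩ := hll T
  rw [jump, leftLim_eq_of_tendsto hx, sub_eq_zero] at hXj
  -- Since the indicator jumps at `T`, the chain does not; with right-continuity it is continuous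
  -- there. An interval on which the indicator flips has `a < T ≤ b`, so both endpoints are close to
  -- `T` once it is short.
  have hcont : ContinuousAt (fun r => X r ω) T := by
    refine continuousAt_iff_continuous_left'_right'.2 ⟨?_, (hrc T).mono Set.Ioi_subset_Ici_self⟩
    rw [ContinuousWithinAt, hXj]
    exact hx
  have hdev : Tendsto (fun r => dev X T r ω) (𝓝 T) (𝓝 0) := by
    have h1 : ∀ l, Tendsto (fun r => |X r ω l - X T ω l|) (𝓝 T) (𝓝 0) := fun l => by
      have h2 : Tendsto (fun r => X r ω l) (𝓝 T) (𝓝 (X T ω l)) :=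
        ((continuous_apply l).tendsto _).comp hcont
      have h3 := (h2.sub_const (X T ω l)).abs
      simpa using h3
    simpa [dev] using tendsto_finsetSum Finset.univ fun l _ => h1 l
  obtain ⟨δ, hδ, hball⟩ := Metric.eventually_nhds_iff.1
    (hdev.eventually (gt_mem_nhds (half_pos hη)))
  refine ⟨δ, hδ, fun a b hab hlt hne => ?_⟩
  rw [hY, hY] at hne
  have haT : a < T := by
    by_contra h
    rw [not_lt] at h
    rw [if_pos h, if_pos (h.trans hab)] at hne
    exact hne rfl
  have hTb : T ≤ b := by
    by_contra h
    rw [if_neg h, if_neg (not_le.2 haT)] at hne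
    exact hne rfl
  have haT' : (a : ℝ) < T := NNReal.coe_lt_coe.2 haT
  have hTb' : (T : ℝ) ≤ b := NNReal.coe_le_coe.2 hTb
  have h1 := hball (y := a) (by rw [NNReal.dist_eq, abs_sub_lt_iff]; constructor <;> linarith)
  have h2 := hball (y := b) (by rw [NNReal.dist_eq, abs_sub_lt_iff]; constructor <;> linarith)
  linarith [dev_triangle (X := X) a b T ω]

-- The indicator is monotone in time, so the sum telescopes to a difference of two values in `{0,
-- 1}`, whatever the number of grid points.
omit mΩ in
lemma sum_abs_defaultInd_sub_le (s t : ℝ≥0) (m : ℕ) (ω : Ω) :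
    ∑ k ∈ Finset.range m, |(1 - defaultInd τ i (gridPoint s t m (k + 1)) ω) -
      (1 - defaultInd τ i (gridPoint s t m k) ω)| ≤ 1 := by
  have h1 : ∀ k, |(1 - defaultInd τ i (gridPoint s t m (k + 1)) ω) -
      (1 - defaultInd τ i (gridPoint s t m k) ω)| =
      defaultInd τ i (gridPoint s t m (k + 1)) ω - defaultInd τ i (gridPoint s t m k) ω := by
    intro k
    rw [sub_sub_sub_cancel_left, abs_sub_comm, abs_of_nonneg (sub_nonneg.2
      (defaultInd_mono i (gridPoint_mono s t m (Nat.le_succ k)) ω))]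
  simp only [h1]
  rw [Finset.sum_range_sub (fun k => defaultInd τ i (gridPoint s t m k) ω)]
  rcases defaultInd_zero_or_one (τ := τ) i (gridPoint s t m m) ω with h | h <;>
    rcases defaultInd_zero_or_one (τ := τ) i (gridPoint s t m 0) ω with h' | h' <;>
    rw [h, h'] <;> norm_num

variable {μ : Measure Ω} [IsProbabilityMeasure μ]
  (hb : ∀ t ω, ∃ k : Fin d, X t ω = Pi.single k 1) (hX : ∀ t, Measurable (X t))
  (hrc : ∀ ω r, ContinuousWithinAt (fun r => X r ω) (Set.Ici r) r)
  (hτ : ∀ i, Measurable (τ i))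

include hτ in
lemma bddMeas_one_sub_defaultInd (i : Fin n) (t : ℝ≥0) :
    BddMeas fun ω => 1 - defaultInd τ i t ω :=
  .of_le ((measurable_defaultInd hτ i t).const_sub 1) (abs_one_sub_defaultInd_le_one i t)

include hb hX hrc hτ in
/-- The sums of the products of the increments vanish in the limit. -/
lemma tendsto_sum_integral_dev_mul
    (hll : ∀ ω t, ∃ x, Tendsto (fun r => X r ω) (𝓝[<] t) (𝓝 x))
    (hj : ∀ᵐ ω ∂μ, ∀ t, jump (fun r => defaultInd τ i r ω) t • jump (fun r => X r ω) t = 0)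
    {s t : ℝ≥0} (hst : s ≤ t) :
    Tendsto (fun m : ℕ => ∑ k ∈ Finset.range m,
      ∫ ω, dev X (gridPoint s t m k) (gridPoint s t m (k + 1)) ω *
        |(1 - defaultInd τ i (gridPoint s t m (k + 1)) ω) -
          (1 - defaultInd τ i (gridPoint s t m k) ω)| ∂μ) atTop (𝓝 0) := by
  have bV := bddMeas_one_sub_defaultInd hτ i
  have bt : ∀ m k, BddMeas fun ω => dev X (gridPoint s t m k) (gridPoint s t m (k + 1)) ω *
        |(1 - defaultInd τ i (gridPoint s t m (k + 1)) ω) -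
          (1 - defaultInd τ i (gridPoint s t m k) ω)| :=
    fun m k => (bddMeas_dev hb hX _ _).mul ((bV _).sub (bV _)).abs
  have h0 : ∀ m : ℕ, ∀ ω, 0 ≤ ∑ k ∈ Finset.range m,
      dev X (gridPoint s t m k) (gridPoint s t m (k + 1)) ω *
        |(1 - defaultInd τ i (gridPoint s t m (k + 1)) ω) -
          (1 - defaultInd τ i (gridPoint s t m k) ω)| := fun m ω =>
    Finset.sum_nonneg fun k _ => mul_nonneg (dev_nonneg _ _ _) (abs_nonneg _)
  -- The dominating constant 2 is the largest deviation of the chain times the total variation 1 of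
  -- the indicator.
  have key := tendsto_integral_of_dominated_convergence (μ := μ) (f := fun _ => (0 : ℝ))
    (F := fun (m : ℕ) ω => ∑ k ∈ Finset.range m,
      dev X (gridPoint s t m k) (gridPoint s t m (k + 1)) ω *
        |(1 - defaultInd τ i (gridPoint s t m (k + 1)) ω) -
          (1 - defaultInd τ i (gridPoint s t m k) ω)|) (fun _ => (2 : ℝ))
    (fun m => (BddMeas.sum fun k _ => bt m k).1.aestronglyMeasurable)
    (integrable_const _) (fun m => Eventually.of_forall fun ω => ?_) ?_
  · rw [integral_zero] at key
    refine key.congr fun m => ?_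
    rw [integral_finsetSum _ fun k _ => (bt m k).integrable]
  · rw [Real.norm_of_nonneg (h0 m ω)]
    calc _ ≤ ∑ k ∈ Finset.range m, 2 * |(1 - defaultInd τ i (gridPoint s t m (k + 1)) ω) -
          (1 - defaultInd τ i (gridPoint s t m k) ω)| := Finset.sum_le_sum fun k _ =>
            mul_le_mul_of_nonneg_right (dev_le_two hb _ _ _) (abs_nonneg _)
      _ ≤ 2 := by
        rw [← Finset.mul_sum]
        linarith [sum_abs_defaultInd_sub_le (τ := τ) (i := i) s t m ω]
  · filter_upwards [hj] with ω hω
    rw [Metric.tendsto_atTop']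
    intro η hη
    obtain ⟨δ, hδ, h⟩ := exists_dev_le_of_defaultInd_ne (hrc ω) (hll ω) hω (half_pos hη)
    have hlim := (tendsto_const_div_atTop_nhds_zero_nat ((t : ℝ) - s)).eventually (gt_mem_nhds hδ)
    obtain ⟨M, hM⟩ := eventually_atTop.1 hlim
    refine ⟨M, fun m hm => ?_⟩
    rw [Real.dist_eq, sub_zero, abs_of_nonneg (h0 m ω)]
    -- Only an interval on which the indicator flips contributes, and on a fine grid the chain moves
    -- by at most `η / 2` across it.
    calc _ ≤ ∑ k ∈ Finset.range m, (η / 2) * |(1 - defaultInd τ i (gridPoint s t m (k + 1)) ω) -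
          (1 - defaultInd τ i (gridPoint s t m k) ω)| := Finset.sum_le_sum fun k _ => by
            by_cases hne : defaultInd τ i (gridPoint s t m k) ω =
                defaultInd τ i (gridPoint s t m (k + 1)) ω
            · simp [hne]
            · exact mul_le_mul_of_nonneg_right (h _ _ (gridPoint_mono s t m (Nat.le_succ k))
                (by rw [coe_gridPoint_succ_sub hst]; exact hM m hm.le) hne) (abs_nonneg _)
      _ ≤ η / 2 := by
        rw [← Finset.mul_sum]
        have := sum_abs_defaultInd_sub_le (τ := τ) (i := i) s t m ω
        nlinarith
      _ < η := by linarith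

/-- The compensator of the default indicator over `(a, b]`. -/
def defaultComp (lam : Fin d → ℝ) (X : ℝ≥0 → Ω → Fin d → ℝ) (τ : Fin n → Ω → ℝ≥0∞) (i : Fin n)
    (a b : ℝ≥0) (ω : Ω) : ℝ :=
  ∫ r in (a : ℝ)..(b : ℝ), (lam ⬝ᵥ X r.toNNReal ω) * (1 - defaultInd τ i r.toNNReal ω)

/-- The weak form of the martingale property of the compensated default indicator. -/
def HasDefaultIntensity (μ : Measure Ω) (lam : Fin d → ℝ) (X : ℝ≥0 → Ω → Fin d → ℝ)
    (τ : Fin n → Ω → ℝ≥0∞) (i : Fin n) (𝔾 : Filtration ℝ≥0 mΩ) : Prop :=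
  ∀ (a b : ℝ≥0) (W : Ω → ℝ), a ≤ b → Measurable[𝔾 a] W → (∀ ω, |W ω| ≤ 1) →
    ∫ ω, W ω * (defaultInd τ i b ω - defaultInd τ i a ω) ∂μ =
      ∫ ω, W ω * defaultComp lam X τ i a b ω ∂μ

include hX hrc hτ in
lemma measurable_uncurry_default_rate (lam : Fin d → ℝ) (i : Fin n) :
    Measurable fun p : ℝ × Ω =>
      (lam ⬝ᵥ X p.1.toNNReal p.2) * (1 - defaultInd τ i p.1.toNNReal p.2) := by
  have hc : Continuous fun x : Fin d → ℝ => lam ⬝ᵥ x := by fun_prop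
  have ht : Measurable fun p : ℝ × Ω => p.1.toNNReal := measurable_real_toNNReal.comp measurable_fst
  refine (hc.measurable.comp ((measurable_uncurry_path hX hrc).comp
    (ht.prodMk measurable_snd))).mul (Measurable.const_sub ?_ 1)
  refine Measurable.ite (measurableSet_le ((hτ i).comp measurable_snd) ?_)
    measurable_const measurable_const
  exact measurable_coe_nnreal_ennreal.comp ht

include hb in
omit mΩ in
lemma abs_default_rate_le (lam : Fin d → ℝ) (i : Fin n) (r : ℝ≥0) (ω : Ω) :
    |(lam ⬝ᵥ X r ω) * (1 - defaultInd τ i r ω)| ≤ ∑ j, |lam j| := by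
  rw [abs_mul]
  exact (mul_le_of_le_one_right (abs_nonneg _) (abs_one_sub_defaultInd_le_one i r ω)).trans
    (abs_dotProduct_path_le hb lam r ω)

include hb hX hrc hτ

lemma intervalIntegrable_default_rate (lam : Fin d → ℝ) (i : Fin n) (ω : Ω) (a b : ℝ) :
    IntervalIntegrable (fun r : ℝ => (lam ⬝ᵥ X r.toNNReal ω) *
      (1 - defaultInd τ i r.toNNReal ω)) volume a b :=
  intervalIntegrable_of_abs_le ((measurable_uncurry_default_rate hX hrc hτ lam i).comp
    (measurable_id.prodMk measurable_const : Measurable fun r : ℝ => (r, ω)))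
    (fun _ => abs_default_rate_le hb lam i _ ω) a b

omit [IsProbabilityMeasure μ] hX hrc hτ mΩ in
lemma abs_defaultComp_le (lam : Fin d → ℝ) (i : Fin n) (a b : ℝ≥0) (ω : Ω) :
    |defaultComp lam X τ i a b ω| ≤ (∑ j, |lam j|) * |(b : ℝ) - a| := by
  rw [defaultComp, ← Real.norm_eq_abs]
  exact intervalIntegral.norm_integral_le_of_norm_le_const
    fun _ _ => abs_default_rate_le hb lam i _ ω

lemma bddMeas_defaultComp (lam : Fin d → ℝ) (i : Fin n) {a b : ℝ≥0} (hab : a ≤ b) :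
    BddMeas (defaultComp lam X τ i a b) := by
  refine .of_le ?_ (abs_defaultComp_le hb lam i a b)
  have h := (measurable_uncurry_default_rate hX hrc hτ lam i).stronglyMeasurable
  have h2 := StronglyMeasurable.integral_prod_left' (μ := volume.restrict (Set.Ioc (a : ℝ) b)) h
  have h3 : defaultComp lam X τ i a b = fun ω => ∫ r in Set.Ioc (a : ℝ) b,
      (lam ⬝ᵥ X r.toNNReal ω) * (1 - defaultInd τ i r.toNNReal ω) := by
    ext ω
    rw [defaultComp, intervalIntegral.integral_of_le (NNReal.coe_le_coe.2 hab)]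
  rw [h3]
  exact h2.measurable

-- The test weight 1 turns the default probability into an expected compensator. The resulting
-- first-order bound controls the error of freezing the survival indicator.
omit hX hrc hτ in
lemma integral_defaultInd_sub_le {lam : Fin d → ℝ} {𝔾 : Filtration ℝ≥0 mΩ}
    (hD : HasDefaultIntensity μ lam X τ i 𝔾) {a b : ℝ≥0} (hab : a ≤ b) :
    ∫ ω, (defaultInd τ i b ω - defaultInd τ i a ω) ∂μ ≤ (∑ j, |lam j|) * ((b : ℝ) - a) := by
  have h1 := hD a b (fun _ => 1) hab measurable_const (by simp)
  simp only [one_mul] at h1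
  rw [h1]
  have h2 := norm_integral_le_of_norm_le_const (μ := μ) (f := defaultComp lam X τ i a b)
    (C := (∑ j, |lam j|) * |(b : ℝ) - a|) (Eventually.of_forall (abs_defaultComp_le hb lam i a b))
  rw [probReal_univ, mul_one, abs_of_nonneg (sub_nonneg.2 (NNReal.coe_le_coe.2 hab))] at h2
  exact (le_abs_self _).trans h2

/-- The chain on survival, tested against the past of the chain and the default indicator. -/
lemma integral_path_mul_survival {Q : Matrix (Fin d) (Fin d) ℝ} {lam : Fin d → ℝ}
    {𝔾 : Filtration ℝ≥0 mΩ} (hXa : ∀ t, Measurable[𝔾 t] (X t))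
    (hYa : ∀ t, Measurable[𝔾 t] (defaultInd τ i t))
    (hQ : SolvesMartingaleProblem μ Q X 𝔾) (hD : HasDefaultIntensity μ lam X τ i 𝔾)
    (hll : ∀ ω t, ∃ x, Tendsto (fun r => X r ω) (𝓝[<] t) (𝓝 x))
    (hj : ∀ᵐ ω ∂μ, ∀ t, jump (fun r => defaultInd τ i r ω) t • jump (fun r => X r ω) t = 0)
    {s t : ℝ≥0} (hst : s ≤ t) {W : Ω → ℝ} (hW : Measurable[𝔾 s] W) (hW1 : ∀ ω, |W ω| ≤ 1) :
    (fun l => ∫ ω, W ω * (X t ω l * (1 - defaultInd τ i t ω)) ∂μ) =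
      NormedSpace.exp (((t : ℝ) - s) • (Q - Matrix.diagonal lam)) *ᵥ
        fun l => ∫ ω, W ω * (X s ω l * (1 - defaultInd τ i s ω)) ∂μ := by
  set S : ℝ := ∑ j, |lam j| with hS
  have hS0 : 0 ≤ S := Finset.sum_nonneg fun _ _ => abs_nonneg _
  set q := entrySum Q
  have hq0 : 0 ≤ q := entrySum_nonneg Q
  have bV := bddMeas_one_sub_defaultInd hτ i
  have bD := bddMeas_dotProduct hb hX lam
  -- `S * q` pays for freezing the chain in the default rate, `S * S` for freezing the survival
  -- indicator.
  refine integral_path_mul_eq_exp (V := fun t ω => 1 - defaultInd τ i t ω) hb hX hrc hXa hQ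
    (C := S * q + S * S) (by positivity)
    (fun a => (hYa a).const_sub 1) (abs_one_sub_defaultInd_le_one i) (fun a b W hab hW hW1 => ?_)
    hst (tendsto_sum_integral_dev_mul hb hX hrc hτ hll hj hst) hW hW1
  have hab' : (a : ℝ) ≤ b := NNReal.coe_le_coe.2 hab
  have bW : BddMeas W := .of_le (hW.mono (𝔾.le a) le_rfl) hW1
  have bC := bddMeas_defaultComp (τ := τ) hb hX hrc hτ lam i hab
  have bL := (BddMeas.const ((b : ℝ) - a)).mul ((bD a).mul (bV a))
  have bdY : BddMeas fun ω => defaultInd τ i b ω - defaultInd τ i a ω := by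
    have := (bV a).sub (bV b)
    simpa only [sub_sub_sub_cancel_left] using this
  -- The martingale property replaces the default increment by its compensator; what remains
  -- compares the rate on `(a, b]` with its value at `a`.
  have h1 : ∫ ω, W ω * ((1 - defaultInd τ i b ω) - (1 - defaultInd τ i a ω) +
      ((b : ℝ) - a) * ((lam ⬝ᵥ X a ω) * (1 - defaultInd τ i a ω))) ∂μ =
      ∫ ω, W ω * (((b : ℝ) - a) * ((lam ⬝ᵥ X a ω) * (1 - defaultInd τ i a ω)) -
        defaultComp lam X τ i a b ω) ∂μ := by
    rw [show (fun ω => W ω * ((1 - defaultInd τ i b ω) - (1 - defaultInd τ i a ω) +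
      ((b : ℝ) - a) * ((lam ⬝ᵥ X a ω) * (1 - defaultInd τ i a ω)))) = fun ω =>
      W ω * (((b : ℝ) - a) * ((lam ⬝ᵥ X a ω) * (1 - defaultInd τ i a ω))) -
        W ω * (defaultInd τ i b ω - defaultInd τ i a ω) from funext fun ω => by ring,
      integral_sub (bW.mul bL).integrable (bW.mul bdY).integrable, hD a b W hab hW hW1,
      ← integral_sub (bW.mul bL).integrable (bW.mul bC).integrable]
    simp only [mul_sub (W _)]
  rw [h1]
  refine (abs_integral_mul_le_of_abs_le_one hW1 (bL.sub bC).integrable).trans ?_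
  have hi := integrable_intervalIntegral_dev (μ := μ) hb hX hrc a b hab
  calc _ ≤ ∫ ω, (S * (∫ r in (a : ℝ)..(b : ℝ), dev X a r.toNNReal ω) +
        S * ((b : ℝ) - a) * (defaultInd τ i b ω - defaultInd τ i a ω)) ∂μ := by
        refine integral_mono (bL.sub bC).abs.integrable
          ((hi.const_mul _).add ((BddMeas.const _).mul bdY).integrable) fun ω => ?_
        have e1 : ((b : ℝ) - a) * ((lam ⬝ᵥ X a ω) * (1 - defaultInd τ i a ω)) =
            ∫ _ in (a : ℝ)..(b : ℝ), (lam ⬝ᵥ X a ω) * (1 - defaultInd τ i a ω) := by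
          rw [intervalIntegral.integral_const, smul_eq_mul]
        have e2 : S * ((b : ℝ) - a) * (defaultInd τ i b ω - defaultInd τ i a ω) =
            ∫ _ in (a : ℝ)..(b : ℝ), S * (defaultInd τ i b ω - defaultInd τ i a ω) := by
          simp only [intervalIntegral.integral_const, smul_eq_mul]
          ring
        have id := (intervalIntegrable_dev hb hX hrc a ω a b).const_mul S
        simp only
        rw [e1, e2, defaultComp, ← intervalIntegral.integral_sub intervalIntegrable_const
          (intervalIntegrable_default_rate hb hX hrc hτ lam i ω _ _),
          ← intervalIntegral.integral_const_mul,
          ← intervalIntegral.integral_add id intervalIntegrable_const, ← Real.norm_eq_abs]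
        refine intervalIntegral.norm_integral_le_of_norm_le hab'
          (Eventually.of_forall fun r hr => ?_) (id.add intervalIntegrable_const)
        have har : a ≤ r.toNNReal := NNReal.le_toNNReal_of_coe_le hr.1.le
        have hrb : r.toNNReal ≤ b := Real.toNNReal_le_iff_le_coe.2 hr.2
        have m1 := defaultInd_mono (τ := τ) i har ω
        have m2 := defaultInd_mono (τ := τ) i hrb ω
        rw [Real.norm_eq_abs, show (lam ⬝ᵥ X a ω) * (1 - defaultInd τ i a ω) -
          (lam ⬝ᵥ X r.toNNReal ω) * (1 - defaultInd τ i r.toNNReal ω) =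
          -(lam ⬝ᵥ X r.toNNReal ω - lam ⬝ᵥ X a ω) * (1 - defaultInd τ i a ω) +
          (lam ⬝ᵥ X r.toNNReal ω) * (defaultInd τ i r.toNNReal ω - defaultInd τ i a ω) by ring]
        refine (abs_add_le _ _).trans (add_le_add ?_ ?_)
        · rw [abs_mul, abs_neg]
          exact (mul_le_of_le_one_right (abs_nonneg _)
            (abs_one_sub_defaultInd_le_one i a ω)).trans (abs_dotProduct_sub_le lam _ _ ω)
        · rw [abs_mul, abs_of_nonneg (sub_nonneg.2 m1)]
          exact mul_le_mul (abs_dotProduct_path_le hb lam _ ω) (by linarith)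
            (sub_nonneg.2 m1) hS0
    _ = S * (∫ ω, (∫ r in (a : ℝ)..(b : ℝ), dev X a r.toNNReal ω) ∂μ) +
        S * ((b : ℝ) - a) * ∫ ω, (defaultInd τ i b ω - defaultInd τ i a ω) ∂μ := by
        rw [integral_add (hi.const_mul _) ((BddMeas.const _).mul bdY).integrable,
          integral_const_mul, integral_const_mul]
    _ ≤ S * (q * ((b : ℝ) - a) ^ 2) + S * ((b : ℝ) - a) * (S * ((b : ℝ) - a)) := by
        refine add_le_add (mul_le_mul_of_nonneg_left
          (integral_intervalIntegral_dev_le hb hX hrc hXa hQ hab) hS0)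
          (mul_le_mul_of_nonneg_left (integral_defaultInd_sub_le hb hD hab) ?_)
        exact mul_nonneg hS0 (sub_nonneg.2 hab')
    _ = _ := by ring

end Default

/-! ### From the martingale hypotheses to their weak forms; the filtrations. -/

section Extraction

variable {μ : Measure Ω} [IsProbabilityMeasure μ]

lemma integral_mul_martingale_sub_eq_zero {𝔾 : Filtration ℝ≥0 mΩ} {M : ℝ≥0 → Ω → ℝ}
    (hM : Martingale M 𝔾 μ) {a b : ℝ≥0} (hab : a ≤ b) {W : Ω → ℝ}
    (hW : Measurable[𝔾 a] W) (hW1 : ∀ ω, |W ω| ≤ 1) :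
    ∫ ω, W ω * (M b ω - M a ω) ∂μ = 0 := by
  have hint : Integrable (M b - M a) μ := (hM.integrable b).sub (hM.integrable a)
  have h1 : μ[M b - M a | 𝔾 a] =ᵐ[μ] 0 := by
    filter_upwards [condExp_sub (hM.integrable b) (hM.integrable a) (𝔾 a),
      hM.condExp_ae_eq hab, hM.condExp_ae_eq (le_refl a)] with ω h1 h2 h3
    rw [h1, Pi.sub_apply, h2, h3]
    simp
  have h2 := condExp_stronglyMeasurable_mul_of_bound (𝔾.le a) hW.stronglyMeasurable hint 1
    (Eventually.of_forall hW1)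
  have h3 : ∫ ω, (W * (M b - M a)) ω ∂μ = 0 := by
    rw [← integral_condExp (𝔾.le a) (f := W * (M b - M a))]
    refine integral_eq_zero_of_ae ?_
    filter_upwards [h1, h2] with ω h1 h2
    rw [h2, Pi.mul_apply, h1]
    simp
  exact h3

omit [IsProbabilityMeasure μ] in
lemma martingale_apply {𝔾 : Filtration ℝ≥0 mΩ} {M : ℝ≥0 → Ω → Fin d → ℝ}
    (hM : Martingale M 𝔾 μ) (l : Fin d) : Martingale (fun t ω => M t ω l) 𝔾 μ := by
  refine ⟨fun t => (continuous_apply l).comp_stronglyMeasurable (hM.1 t), fun a b hab => ?_⟩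
  have h := (ContinuousLinearMap.proj (R := ℝ) (φ := fun _ : Fin d => ℝ) l).comp_condExp_comm
    (m := 𝔾 a) (hM.integrable b)
  filter_upwards [h, hM.2 a b hab] with ω h1 h2
  have h3 : μ[fun ω => M b ω l | 𝔾 a] ω = (μ[M b | 𝔾 a] ω) l := h1.symm
  rw [h3, h2]

variable {X : ℝ≥0 → Ω → Fin d → ℝ} {τ : Fin n → Ω → ℝ≥0∞} {Q : Matrix (Fin d) (Fin d) ℝ}
  {lam : Fin d → ℝ}
  (hb : ∀ t ω, ∃ k : Fin d, X t ω = Pi.single k 1) (hX : ∀ t, Measurable (X t))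
  (hrc : ∀ ω r, ContinuousWithinAt (fun r => X r ω) (Set.Ici r) r)
  (hτ : ∀ i, Measurable (τ i))

omit [IsProbabilityMeasure μ] in
include hb hX hrc in
lemma chainNoise_apply (t : ℝ≥0) (ω : Ω) (l : Fin d) :
    chainNoise Q X t ω l = X t ω l - X 0 ω l - addFun (Q l) X t ω := by
  have h0 : (0 : ℝ) ≤ t := t.2
  rw [chainNoise, addFun, Pi.sub_apply, Pi.sub_apply, intervalIntegral.integral_of_le h0,
    intervalIntegral.integral_of_le h0, eval_integral]
  · rfl
  · intro j
    have := intervalIntegrable_dotProduct hb hX hrc (Q j) ω 0 t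
    rw [intervalIntegrable_iff_integrableOn_Ioc_of_le h0] at this
    exact this

include hb hX hrc in
lemma solvesMartingaleProblem_of_martingale {𝔾 : Filtration ℝ≥0 mΩ}
    (hM : Martingale (chainNoise Q X) 𝔾 μ) : SolvesMartingaleProblem μ Q X 𝔾 := by
  intro l a b W hab hW hW1
  have h := integral_mul_martingale_sub_eq_zero (martingale_apply hM l) hab hW hW1
  have bW : BddMeas W := .of_le (hW.mono (𝔾.le a) le_rfl) hW1
  have bX := bddMeas_path hb hX
  have bA : BddMeas fun ω => addFun (Q l) X b ω - addFun (Q l) X a ω :=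
    .of_le ((measurable_addFun_ambient hX hrc (Q l) b).sub
      (measurable_addFun_ambient hX hrc (Q l) a)) (abs_addFun_sub_le hb hX hrc (Q l) hab)
  rw [← sub_eq_zero, ← integral_sub (bW.mul ((bX b l).sub (bX a l))).integrable
    (bW.mul bA).integrable, ← h]
  congr 1
  ext ω
  rw [chainNoise_apply hb hX hrc, chainNoise_apply hb hX hrc]
  ring

include hb hX hrc hτ in
lemma hasDefaultIntensity_of_martingale {𝔾 : Filtration ℝ≥0 mΩ} {i : Fin n}
    (hM : Martingale (defaultNoise lam X τ i) 𝔾 μ) : HasDefaultIntensity μ lam X τ i 𝔾 := by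
  intro a b W hab hW hW1
  have h := integral_mul_martingale_sub_eq_zero hM hab hW hW1
  have bW : BddMeas W := .of_le (hW.mono (𝔾.le a) le_rfl) hW1
  have bY : BddMeas fun ω => defaultInd τ i b ω - defaultInd τ i a ω := by
    have := (bddMeas_one_sub_defaultInd hτ i a).sub (bddMeas_one_sub_defaultInd hτ i b)
    simpa only [sub_sub_sub_cancel_left] using this
  have bC := bddMeas_defaultComp hb hX hrc hτ lam i hab
  rw [← sub_eq_zero, ← integral_sub (bW.mul bY).integrable (bW.mul bC).integrable, ← h]
  congr 1
  ext ω
  have h1 : defaultComp lam X τ i a b ω =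
      (∫ r in (0 : ℝ)..(b : ℝ), (lam ⬝ᵥ X r.toNNReal ω) * (1 - defaultInd τ i r.toNNReal ω)) -
      ∫ r in (0 : ℝ)..(a : ℝ), (lam ⬝ᵥ X r.toNNReal ω) * (1 - defaultInd τ i r.toNNReal ω) :=
    (intervalIntegral.integral_interval_sub_left
      (intervalIntegrable_default_rate hb hX hrc hτ lam i ω _ _)
      (intervalIntegrable_default_rate hb hX hrc hτ lam i ω _ _)).symm
  rw [h1, defaultNoise, defaultNoise]
  ring

-- A smaller filtration has fewer test weights. This passes the chain property from the full
-- filtration to that of one obligor.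
omit [IsProbabilityMeasure μ] in
lemma SolvesMartingaleProblem.mono {𝔾 ℍ : Filtration ℝ≥0 mΩ}
    (h : SolvesMartingaleProblem μ Q X 𝔾) (hle : ∀ t, ℍ t ≤ 𝔾 t) :
    SolvesMartingaleProblem μ Q X ℍ :=
  fun l a b W hab hW hW1 => h l a b W hab (hW.mono (hle a) le_rfl) hW1

lemma measurable_full_pair (t : ℝ≥0) : Measurable[fullFiltration X τ hX hτ t]
    fun ω => (X t ω, fun i => defaultInd τ i t ω) := by
  have : MeasurableSpace.comap (fun ω => (X t ω, fun i => defaultInd τ i t ω)) inferInstance ≤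
      fullFiltration X τ hX hτ t :=
    le_iSup₂_of_le (f := fun (j : ℝ≥0) (_ : j ≤ t) =>
      MeasurableSpace.comap (fun ω => (X j ω, fun i => defaultInd τ i j ω)) inferInstance) t
      le_rfl le_rfl
  exact Measurable.mono (comap_measurable _) this le_rfl

lemma measurable_full_path (t : ℝ≥0) : Measurable[fullFiltration X τ hX hτ t] (X t) :=
  measurable_fst.comp (measurable_full_pair hX hτ t)

lemma measurable_full_default (i : Fin n) (t : ℝ≥0) :
    Measurable[fullFiltration X τ hX hτ t] (defaultInd τ i t) :=
  (measurable_pi_apply i).comp (measurable_snd.comp (measurable_full_pair hX hτ t))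

lemma measurable_obligor_pair (i : Fin n) (t : ℝ≥0) :
    Measurable[obligorFiltration X τ hX hτ i t] fun ω => (X t ω, defaultInd τ i t ω) := by
  have : MeasurableSpace.comap (fun ω => (X t ω, defaultInd τ i t ω)) inferInstance ≤
      obligorFiltration X τ hX hτ i t :=
    le_iSup₂_of_le (f := fun (j : ℝ≥0) (_ : j ≤ t) =>
      MeasurableSpace.comap (fun ω => (X j ω, defaultInd τ i j ω)) inferInstance) t le_rfl le_rfl
  exact Measurable.mono (comap_measurable _) this le_rfl

lemma fullFiltration_le {m : MeasurableSpace Ω} {t : ℝ≥0}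
    (h1 : ∀ r ≤ t, Measurable[m] (X r)) (h2 : ∀ i, ∀ r ≤ t, Measurable[m] (defaultInd τ i r)) :
    fullFiltration (mΩ := mΩ) X τ hX hτ t ≤ m := by
  refine iSup₂_le fun r hr => ?_
  have h3 : Measurable[m] fun ω => (X r ω, fun i => defaultInd τ i r ω) :=
    (h1 r hr).prodMk (measurable_pi_lambda _ fun i => h2 i r hr)
  exact h3.comap_le

lemma obligorFiltration_le {m : MeasurableSpace Ω} {t : ℝ≥0} {i : Fin n}
    (h1 : ∀ r ≤ t, Measurable[m] (X r)) (h2 : ∀ r ≤ t, Measurable[m] (defaultInd τ i r)) :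
    obligorFiltration (mΩ := mΩ) X τ hX hτ i t ≤ m := by
  refine iSup₂_le fun r hr => ?_
  have h3 : Measurable[m] fun ω => (X r ω, defaultInd τ i r ω) := (h1 r hr).prodMk (h2 r hr)
  exact h3.comap_le

lemma obligorFiltration_le_fullFiltration (i : Fin n) (t : ℝ≥0) :
    obligorFiltration X τ hX hτ i t ≤ fullFiltration X τ hX hτ t :=
  obligorFiltration_le (mΩ := mΩ) hX hτ
    (fun r hr => (measurable_full_path hX hτ r).mono
      ((fullFiltration X τ hX hτ).mono hr) le_rfl)
    (fun r hr => (measurable_full_default hX hτ i r).mono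
      ((fullFiltration X τ hX hτ).mono hr) le_rfl)

end Extraction

/-! ### Survival of one obligor given the whole path of the chain. -/

section Survival

variable {X : ℝ≥0 → Ω → Fin d → ℝ} {τ : Fin n → Ω → ℝ≥0∞} {i : Fin n}
  {μ : Measure Ω} [IsProbabilityMeasure μ]
  {Q : Matrix (Fin d) (Fin d) ℝ} {lam : Fin d → ℝ} {𝔾 : Filtration ℝ≥0 mΩ}

/-- The difference of the survival indicator and its candidate projection on the path of the
chain. -/
def survivalGap (lam : Fin d → ℝ) (X : ℝ≥0 → Ω → Fin d → ℝ) (τ : Fin n → Ω → ℝ≥0∞) (i : Fin n)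
    (t : ℝ≥0) (ω : Ω) : ℝ :=
  (1 - defaultInd τ i t ω) - Real.exp (-addFun lam X t ω) * (1 - defaultInd τ i 0 ω)

variable (hb : ∀ t ω, ∃ k : Fin d, X t ω = Pi.single k 1) (hX : ∀ t, Measurable (X t))
  (hrc : ∀ ω r, ContinuousWithinAt (fun r => X r ω) (Set.Ici r) r)
  (hτ : ∀ i, Measurable (τ i)) (hlam : ∀ j, 0 ≤ lam j)

include hb hlam in
omit mΩ in
lemma abs_survivalGap_le_one (t : ℝ≥0) (ω : Ω) : |survivalGap lam X τ i t ω| ≤ 1 := by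
  have h1 : Real.exp (-addFun lam X t ω) ≤ 1 :=
    Real.exp_le_one_iff.2 (neg_nonpos.2 (addFun_nonneg hb hlam ω t))
  have h2 := Real.exp_pos (-addFun lam X t ω)
  unfold survivalGap
  rw [abs_le]
  rcases defaultInd_zero_or_one (τ := τ) i t ω with h | h <;>
    rcases defaultInd_zero_or_one (τ := τ) i 0 ω with h' | h' <;>
    rw [h, h'] <;> constructor <;> linarith

omit mΩ in
lemma survivalGap_zero (ω : Ω) : survivalGap lam X τ i 0 ω = 0 := by
  simp [survivalGap, addFun]

include hrc in
lemma measurable_survivalGap (hXa : ∀ t, Measurable[𝔾 t] (X t))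
    (hYa : ∀ t, Measurable[𝔾 t] (defaultInd τ i t)) (t : ℝ≥0) :
    Measurable[𝔾 t] (survivalGap lam X τ i t) := by
  have h0 : Measurable[𝔾 t] (defaultInd τ i 0) := (hYa 0).mono (𝔾.mono zero_le) le_rfl
  exact ((hYa t).const_sub 1).sub ((Real.measurable_exp.comp
    (measurable_addFun hrc lam t fun r hr => (hXa r).mono (𝔾.mono hr) le_rfl).neg).mul
      (h0.const_sub 1))

include hb hX hrc hτ hlam

/-- Both halves of the gap, multiplied by `X`, have the generator `Q - diag λ`. The factor `1 -
Y^i_0` is known at time `s` and is absorbed into the weight of the Feynman-Kac formula. -/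
lemma integral_path_mul_survivalGap (hXa : ∀ t, Measurable[𝔾 t] (X t))
    (hYa : ∀ t, Measurable[𝔾 t] (defaultInd τ i t))
    (hQ : SolvesMartingaleProblem μ Q X 𝔾) (hD : HasDefaultIntensity μ lam X τ i 𝔾)
    (hll : ∀ ω t, ∃ x, Tendsto (fun r => X r ω) (𝓝[<] t) (𝓝 x))
    (hj : ∀ᵐ ω ∂μ, ∀ t, jump (fun r => defaultInd τ i r ω) t • jump (fun r => X r ω) t = 0)
    {s t : ℝ≥0} (hst : s ≤ t) {W : Ω → ℝ} (hW : Measurable[𝔾 s] W) (hW1 : ∀ ω, |W ω| ≤ 1) :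
    (fun l => ∫ ω, W ω * (X t ω l * survivalGap lam X τ i t ω) ∂μ) =
      NormedSpace.exp (((t : ℝ) - s) • (Q - Matrix.diagonal lam)) *ᵥ
        fun l => ∫ ω, W ω * (X s ω l * survivalGap lam X τ i s ω) ∂μ := by
  have h0 : Measurable[𝔾 s] (defaultInd τ i 0) := (hYa 0).mono (𝔾.mono zero_le) le_rfl
  have e1 := integral_path_mul_survival hb hX hrc hτ hXa hYa hQ hD hll hj hst hW hW1
  have e2 := integral_path_mul_exp_addFun (μ := μ) hb hX hrc hXa hQ hlam hst
    (W := fun ω => W ω * (1 - defaultInd τ i 0 ω)) (hW.mul (h0.const_sub 1)) fun ω => by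
      rw [abs_mul]
      exact mul_le_one₀ (hW1 ω) (abs_nonneg _) (abs_one_sub_defaultInd_le_one i 0 ω)
  have bW : BddMeas W := .of_le (hW.mono (𝔾.le s) le_rfl) hW1
  have bX := bddMeas_path hb hX
  have bY := bddMeas_one_sub_defaultInd hτ i
  have bE : ∀ r, BddMeas fun ω => Real.exp (-addFun lam X r ω) := fun r =>
    .of_le (C := 1) (Real.measurable_exp.comp (measurable_addFun_ambient hX hrc lam r).neg)
      fun ω => by
        rw [abs_of_pos (Real.exp_pos _), Real.exp_le_one_iff]
        linarith [addFun_nonneg hb hlam ω r]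
  have hsplit : ∀ r, (fun l => ∫ ω, W ω * (X r ω l * survivalGap lam X τ i r ω) ∂μ) =
      (fun l => ∫ ω, W ω * (X r ω l * (1 - defaultInd τ i r ω)) ∂μ) -
      fun l => ∫ ω, (W ω * (1 - defaultInd τ i 0 ω)) *
        (X r ω l * Real.exp (-addFun lam X r ω)) ∂μ := by
    intro r
    ext l
    rw [Pi.sub_apply, ← integral_sub (bW.mul ((bX r l).mul (bY r))).integrable
      ((bW.mul (bY 0)).mul ((bX r l).mul (bE r))).integrable]
    congr 1
    ext ω
    rw [survivalGap]
    ring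
  rw [hsplit, hsplit, e1, e2, Matrix.mulVec_sub]

-- Feynman-Kac with zero potential.
omit hτ hlam in
lemma integral_path_mul_of_measurable (hXa : ∀ t, Measurable[𝔾 t] (X t))
    (hQ : SolvesMartingaleProblem μ Q X 𝔾) {s t : ℝ≥0} (hst : s ≤ t) {W : Ω → ℝ}
    (hW : Measurable[𝔾 s] W) (hW1 : ∀ ω, |W ω| ≤ 1) :
    (fun l => ∫ ω, W ω * X t ω l ∂μ) =
      NormedSpace.exp (((t : ℝ) - s) • Q) *ᵥ fun l => ∫ ω, W ω * X s ω l ∂μ := by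
  have h := integral_path_mul_exp_addFun (μ := μ) (v := 0) hb hX hrc hXa hQ (fun _ => le_rfl)
    hst hW hW1
  simpa [addFun] using h

/-- Cylinder events may involve times after `T`, so the gap is frozen at `T`: up to `T` the product
has the generator `Q - diag λ`; afterwards the gap is a known weight and only the chain moves, with
generator `Q`. Which matrix `P` results is irrelevant: it is only used to map zero to zero. -/
lemma exists_integral_path_mul_stopped (hXa : ∀ t, Measurable[𝔾 t] (X t))
    (hYa : ∀ t, Measurable[𝔾 t] (defaultInd τ i t))
    (hQ : SolvesMartingaleProblem μ Q X 𝔾) (hD : HasDefaultIntensity μ lam X τ i 𝔾)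
    (hll : ∀ ω t, ∃ x, Tendsto (fun r => X r ω) (𝓝[<] t) (𝓝 x))
    (hj : ∀ᵐ ω ∂μ, ∀ t, jump (fun r => defaultInd τ i r ω) t • jump (fun r => X r ω) t = 0)
    (T : ℝ≥0) {a b : ℝ≥0} (hab : a ≤ b) {W : Ω → ℝ} (hW : Measurable[𝔾 a] W)
    (hW1 : ∀ ω, |W ω| ≤ 1) :
    ∃ P : Matrix (Fin d) (Fin d) ℝ,
      (fun l => ∫ ω, W ω * (X b ω l * survivalGap lam X τ i (min b T) ω) ∂μ) =
        P *ᵥ fun l => ∫ ω, W ω * (X a ω l * survivalGap lam X τ i (min a T) ω) ∂μ := by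
  have hZ1 : ∀ r ω, |survivalGap lam X τ i r ω| ≤ 1 := abs_survivalGap_le_one hb hlam
  have hZm := measurable_survivalGap (lam := lam) hrc hXa hYa
  have late : ∀ a : ℝ≥0, T ≤ a → a ≤ b → Measurable[𝔾 a] W →
      (fun l => ∫ ω, W ω * (X b ω l * survivalGap lam X τ i T ω) ∂μ) =
        NormedSpace.exp (((b : ℝ) - a) • Q) *ᵥ
          fun l => ∫ ω, W ω * (X a ω l * survivalGap lam X τ i T ω) ∂μ := by
    intro a hTa hab hW
    have h := integral_path_mul_of_measurable (μ := μ) hb hX hrc hXa hQ hab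
      (W := fun ω => W ω * survivalGap lam X τ i T ω)
      (hW.mul ((hZm T).mono (𝔾.mono hTa) le_rfl)) fun ω => by
        rw [abs_mul]
        exact mul_le_one₀ (hW1 ω) (abs_nonneg _) (hZ1 T ω)
    have e : ∀ r l, (fun ω => W ω * (X r ω l * survivalGap lam X τ i T ω)) =
        fun ω => W ω * survivalGap lam X τ i T ω * X r ω l := fun r l => by
      ext ω
      ring
    simpa only [e] using h
  rcases le_total b T with hbT | hTb
  · rw [min_eq_left hbT, min_eq_left (hab.trans hbT)]
    exact ⟨_, integral_path_mul_survivalGap hb hX hrc hτ hlam hXa hYa hQ hD hll hj hab hW hW1⟩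
  rcases le_total T a with hTa | haT
  · rw [min_eq_right hTb, min_eq_right hTa]
    exact ⟨_, late a hTa hab hW⟩
  · rw [min_eq_right hTb, min_eq_left haT]
    refine ⟨NormedSpace.exp (((b : ℝ) - T) • Q) *
      NormedSpace.exp (((T : ℝ) - a) • (Q - Matrix.diagonal lam)), ?_⟩
    rw [late T le_rfl hTb (hW.mono (𝔾.mono haT) le_rfl),
      integral_path_mul_survivalGap hb hX hrc hτ hlam hXa hYa hQ hD hll hj haT hW hW1,
      Matrix.mulVec_mulVec]

/-- Induction on the latest cylinder time `a`. Linear propagation leads from `r` back to `a`; there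
the event at time `a` becomes a constant in each coordinate, and the earlier times fall to the
induction hypothesis. With no times left, the gap is zero at time 0. -/
lemma integral_cylinder_mul_survivalGap (hXa : ∀ t, Measurable[𝔾 t] (X t))
    (hYa : ∀ t, Measurable[𝔾 t] (defaultInd τ i t))
    (hQ : SolvesMartingaleProblem μ Q X 𝔾) (hD : HasDefaultIntensity μ lam X τ i 𝔾)
    (hll : ∀ ω t, ∃ x, Tendsto (fun r => X r ω) (𝓝[<] t) (𝓝 x))
    (hj : ∀ᵐ ω ∂μ, ∀ t, jump (fun r => defaultInd τ i r ω) t • jump (fun r => X r ω) t = 0)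
    (T : ℝ≥0) (f : ℝ≥0 → Set Ω) (S : Finset ℝ≥0)
    (hf : ∀ x ∈ S, MeasurableSet[MeasurableSpace.comap (X x) inferInstance] (f x))
    (r : ℝ≥0) (hr : ∀ x ∈ S, x ≤ r) (l : Fin d) :
    ∫ ω, (⋂ x ∈ S, f x).indicator (fun _ => (1 : ℝ)) ω *
      (X r ω l * survivalGap lam X τ i (min r T) ω) ∂μ = 0 := by
  have hInd : ∀ (A : Set Ω) ω, |A.indicator (fun _ => (1 : ℝ)) ω| ≤ 1 := fun A ω => by
    by_cases h : ω ∈ A <;> simp [h]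
  induction S using Finset.induction_on_max generalizing r l with
  | empty =>
    obtain ⟨P, hP⟩ := exists_integral_path_mul_stopped (μ := μ) hb hX hrc hτ hlam hXa hYa hQ hD hll
      hj T zero_le (W := fun _ => 1) measurable_const (by simp)
    have h0 : min 0 T = 0 := min_eq_left zero_le
    have h1 := congrFun hP l
    simp only [h0, survivalGap_zero, mul_zero, integral_zero] at h1
    simp only [Finset.notMem_empty, Set.iInter_of_empty, Set.iInter_univ, Set.indicator_univ]
    rw [h1]
    exact congrFun (Matrix.mulVec_zero P) l
  | insert a S ha ih =>
    have hfS := fun x (hx : x ∈ S) => hf x (Finset.mem_insert_of_mem hx)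
    have har : a ≤ r := hr a (Finset.mem_insert_self a S)
    obtain ⟨B, -, hBa⟩ := hf a (Finset.mem_insert_self a S)
    have hmeas : MeasurableSet[𝔾 a] (⋂ x ∈ insert a S, f x) := by
      refine Finset.measurableSet_biInter _ fun x hx => ?_
      have hxa : x ≤ a := by
        rcases Finset.mem_insert.1 hx with rfl | h
        · exact le_rfl
        · exact (ha x h).le
      exact ((hXa x).mono (𝔾.mono hxa) le_rfl).comap_le _ (hf x hx)
    obtain ⟨P, hP⟩ := exists_integral_path_mul_stopped (μ := μ) hb hX hrc hτ hlam hXa hYa hQ hD hll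
      hj T har (W := (⋂ x ∈ insert a S, f x).indicator fun _ => 1)
      (measurable_const.indicator hmeas) (hInd _)
    have h1 := congrFun hP l
    rw [h1]
    have h2 : (fun l => ∫ ω, (⋂ x ∈ insert a S, f x).indicator (fun _ => (1 : ℝ)) ω *
        (X a ω l * survivalGap lam X τ i (min a T) ω) ∂μ) = 0 := by
      ext l
      -- The `l`-th coordinate of `X_a` is nonzero only if `X_a = e_l`, and then `X_a ∈ B` means
      -- `e_l ∈ B`.
      have h3 : ∀ ω, (⋂ x ∈ insert a S, f x).indicator (fun _ => (1 : ℝ)) ω *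
          (X a ω l * survivalGap lam X τ i (min a T) ω) =
          B.indicator (fun _ => (1 : ℝ)) (Pi.single l 1) *
          ((⋂ x ∈ S, f x).indicator (fun _ => (1 : ℝ)) ω *
            (X a ω l * survivalGap lam X τ i (min a T) ω)) := by
        intro ω
        rw [Finset.set_biInter_insert, ← hBa]
        obtain ⟨k, hk⟩ := hb a ω
        by_cases hkl : l = k
        · subst hkl
          by_cases h4 : (Pi.single l 1 : Fin d → ℝ) ∈ B <;> by_cases h5 : ω ∈ ⋂ x ∈ S, f x <;>
            simp [Set.indicator, hk, h4, h5]
        · simp [hk, hkl]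
      simp only [h3]
      rw [integral_const_mul, ih hfS a (fun x hx => (ha x hx).le) l, mul_zero, Pi.zero_apply]
    rw [h2, Matrix.mulVec_zero, Pi.zero_apply]

/-- Given the path of the chain, survival up to `T` has the conditional probability
`exp (-∫_0^T λᵀ X_r dr)`. -/
lemma setIntegral_survival (hXa : ∀ t, Measurable[𝔾 t] (X t))
    (hYa : ∀ t, Measurable[𝔾 t] (defaultInd τ i t))
    (hQ : SolvesMartingaleProblem μ Q X 𝔾) (hD : HasDefaultIntensity μ lam X τ i 𝔾)
    (hll : ∀ ω t, ∃ x, Tendsto (fun r => X r ω) (𝓝[<] t) (𝓝 x))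
    (hj : ∀ᵐ ω ∂μ, ∀ t, jump (fun r => defaultInd τ i r ω) t • jump (fun r => X r ω) t = 0)
    (T : ℝ≥0) {G : Set Ω} (hG : MeasurableSet[pathSigma X] G) :
    ∫ ω in G, (1 - defaultInd τ i T ω) ∂μ =
      ∫ ω in G, Real.exp (-addFun lam X T ω) * (1 - defaultInd τ i 0 ω) ∂μ := by
  have hle : pathSigma X ≤ mΩ := iSup_le fun t => (hX t).comap_le
  have bX := bddMeas_path hb hX
  have bY := bddMeas_one_sub_defaultInd hτ i
  have bE : BddMeas fun ω => Real.exp (-addFun lam X T ω) :=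
    .of_le (C := 1) (Real.measurable_exp.comp (measurable_addFun_ambient hX hrc lam T).neg)
      fun ω => by
        rw [abs_of_pos (Real.exp_pos _), Real.exp_le_one_iff]
        linarith [addFun_nonneg hb hlam ω T]
  have hgen : pathSigma X = MeasurableSpace.generateFrom
      (piiUnionInter (fun t : ℝ≥0 =>
        {s | MeasurableSet[MeasurableSpace.comap (X t) inferInstance] s}) Set.univ) := by
    rw [generateFrom_piiUnionInter_measurableSet
      (fun t : ℝ≥0 => MeasurableSpace.comap (X t) inferInstance)]
    simp [pathSigma]
  have hcyl : ∀ G ∈ piiUnionInter (fun t : ℝ≥0 =>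
        {s | MeasurableSet[MeasurableSpace.comap (X t) inferInstance] s}) Set.univ,
      ∫ ω in G, (1 - defaultInd τ i T ω) ∂μ =
        ∫ ω in G, Real.exp (-addFun lam X T ω) * (1 - defaultInd τ i 0 ω) ∂μ := by
    intro G hG
    have hGm : MeasurableSet G := hle _ (by rw [hgen]; exact .basic _ hG)
    obtain ⟨S, -, f, hf, rfl⟩ := hG
    have bG : BddMeas ((⋂ x ∈ S, f x).indicator fun _ => (1 : ℝ)) :=
      .of_le (C := 1) (measurable_const.indicator hGm) fun ω => by
        by_cases h : ω ∈ ⋂ x ∈ S, f x <;> simp only [Set.indicator, h] <;> simp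
    -- A time after `T` and after all cylinder times; summing over the coordinates of `X_r` then
    -- removes the chain, as they add up to 1.
    set r : ℝ≥0 := S.sup id ⊔ T with hr
    have h1 := fun l => integral_cylinder_mul_survivalGap (μ := μ) hb hX hrc hτ hlam hXa hYa hQ hD
      hll hj T f S hf r (fun x hx => (Finset.le_sup (f := id) hx).trans le_sup_left) l
    rw [min_eq_right le_sup_right] at h1
    have bZ : BddMeas (survivalGap lam X τ i T) := (bY T).sub (bE.mul (bY 0))
    rw [← sub_eq_zero, ← integral_sub (bY T).integrable.integrableOn
      (bE.mul (bY 0)).integrable.integrableOn, ← integral_indicator hGm]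
    have h2 : ∀ ω, (⋂ x ∈ S, f x).indicator (fun ω => 1 - defaultInd τ i T ω -
        Real.exp (-addFun lam X T ω) * (1 - defaultInd τ i 0 ω)) ω =
        ∑ l, (⋂ x ∈ S, f x).indicator (fun _ => (1 : ℝ)) ω *
          (X r ω l * survivalGap lam X τ i T ω) := by
      intro ω
      rw [← Finset.mul_sum, ← Finset.sum_mul, sum_path hb, one_mul]
      by_cases h : ω ∈ ⋂ x ∈ S, f x <;> simp only [Set.indicator, h] <;> simp [survivalGap]
    simp only [h2]
    rw [integral_finsetSum _ fun l _ => (bG.mul ((bX r l).mul bZ)).integrable]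
    exact Finset.sum_eq_zero fun l _ => h1 l
  refine setIntegral_eq_of_piSystem hle hgen
    (isPiSystem_piiUnionInter _ (fun t => @MeasurableSpace.isPiSystem_measurableSet _
      (MeasurableSpace.comap (X t) inferInstance)) _) (bY T).integrable
    (bE.mul (bY 0)).integrable ?_ hcyl G hG
  have := hcyl Set.univ ⟨∅, by simp, fun _ => Set.univ, by simp, by simp⟩
  simpa using this

end Survival

/-! ### Joint survival by conditional independence. -/

section Projection

variable {X : ℝ≥0 → Ω → Fin d → ℝ} {τ : Fin n → Ω → ℝ≥0∞}
  {μ : Measure Ω} [IsProbabilityMeasure μ] {lam : Fin d → ℝ}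

omit mΩ in
lemma one_sub_defaultInd_eq_indicator (i : Fin n) (t : ℝ≥0) :
    (fun ω => 1 - defaultInd τ i t ω) =
      (τ i ⁻¹' Set.Ioi (t : ℝ≥0∞)).indicator fun _ => (1 : ℝ) := by
  ext ω
  by_cases h : τ i ω ≤ t
  · simp [defaultInd, h]
  · simp [defaultInd, h, not_le.1 h]

lemma pathSigma_le (hX : ∀ t, Measurable (X t)) : pathSigma X ≤ mΩ :=
  iSup_le fun t => (hX t).comap_le

omit mΩ in
lemma measurable_pathSigma (t : ℝ≥0) : Measurable[pathSigma X] (X t) :=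
  (comap_measurable (X t)).mono (le_iSup (fun t => MeasurableSpace.comap (X t) inferInstance) t)
    le_rfl

/-- The survival probability of obligor `i` given the path of the chain. -/
def HasConditionalSurvival (μ : Measure Ω) (lam : Fin d → ℝ) (X : ℝ≥0 → Ω → Fin d → ℝ)
    (τ : Fin n → Ω → ℝ≥0∞) (i : Fin n) : Prop :=
  ∀ (t : ℝ≥0) (G : Set Ω), MeasurableSet[pathSigma X] G →
    ∫ ω in G, (1 - defaultInd τ i t ω) ∂μ =
      ∫ ω in G, Real.exp (-addFun lam X t ω) * (1 - defaultInd τ i 0 ω) ∂μ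

variable (hb : ∀ t ω, ∃ k : Fin d, X t ω = Pi.single k 1) (hX : ∀ t, Measurable (X t))
  (hrc : ∀ ω r, ContinuousWithinAt (fun r => X r ω) (Set.Ici r) r)
  (hτ : ∀ i, Measurable (τ i)) (hlam : ∀ j, 0 ≤ lam j)

include hb hlam in
omit mΩ in
lemma abs_exp_neg_addFun_le_one (t : ℝ≥0) (ω : Ω) : |Real.exp (-addFun lam X t ω)| ≤ 1 := by
  rw [abs_of_pos (Real.exp_pos _), Real.exp_le_one_iff]
  linarith [addFun_nonneg hb hlam ω t]

include hrc in
omit mΩ in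
lemma measurable_exp_neg_addFun_pathSigma (t : ℝ≥0) :
    Measurable[pathSigma X] fun ω => Real.exp (-addFun lam X t ω) :=
  Real.measurable_exp.comp (measurable_addFun hrc lam t fun r _ => measurable_pathSigma r).neg

include hb hX hrc hτ hlam

/-- The exponential is a function of the path and can be pulled out of the conditional expectation.
-/
lemma condExp_survival_zero {i : Fin n} (hS : HasConditionalSurvival μ lam X τ i) (t : ℝ≥0) :
    μ[fun ω => 1 - defaultInd τ i t ω | pathSigma X] =ᵐ[μ]
      fun ω => Real.exp (-addFun lam X t ω) *
        μ[fun ω => 1 - defaultInd τ i 0 ω | pathSigma X] ω := by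
  have hle := pathSigma_le hX
  have bY := bddMeas_one_sub_defaultInd hτ i
  have h1 := condExp_stronglyMeasurable_mul_of_bound hle
    (measurable_exp_neg_addFun_pathSigma (lam := lam) hrc t).stronglyMeasurable
    (bY 0).integrable (μ := μ) 1 (Eventually.of_forall (abs_exp_neg_addFun_le_one hb hlam t))
  have bE : BddMeas fun ω => Real.exp (-addFun lam X t ω) :=
    .of_le ((measurable_exp_neg_addFun_pathSigma hrc t).mono hle le_rfl)
      (abs_exp_neg_addFun_le_one hb hlam t)
  have h2 : μ[(fun ω => Real.exp (-addFun lam X t ω)) * (fun ω => 1 - defaultInd τ i 0 ω) |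
      pathSigma X] =ᵐ[μ] μ[fun ω => 1 - defaultInd τ i t ω | pathSigma X] := by
    refine ae_eq_condExp_of_forall_setIntegral_eq hle (bY t).integrable
      (fun G _ _ => integrable_condExp.integrableOn) (fun G hG _ => ?_)
      stronglyMeasurable_condExp.aestronglyMeasurable
    exact (setIntegral_condExp hle (bE.mul (bY 0)).integrable hG).trans (hS t G hG).symm
  exact h2.symm.trans h1

/-- The quotient of the formulas at `t` and at `s`: the exponential never vanishes, so the initial
survival probability cancels. -/
lemma condExp_survival {i : Fin n} (hS : HasConditionalSurvival μ lam X τ i) (s t : ℝ≥0) :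
    μ[fun ω => 1 - defaultInd τ i t ω | pathSigma X] =ᵐ[μ]
      fun ω => Real.exp (-(addFun lam X t ω - addFun lam X s ω)) *
        μ[fun ω => 1 - defaultInd τ i s ω | pathSigma X] ω := by
  filter_upwards [condExp_survival_zero hb hX hrc hτ hlam hS t,
    condExp_survival_zero hb hX hrc hτ hlam hS s] with ω h1 h2
  rw [h1, h2, ← mul_assoc, ← Real.exp_add]
  ring_nf

omit hb hrc hlam in
/-- Conditional independence with a weight that depends on the path of the chain. -/
lemma setIntegral_mul_indicator_iInter (hci : CondIndepTimes μ (pathSigma X) τ)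
    {h : Ω → ℝ} (hm : Measurable[pathSigma X] h) (h1 : ∀ ω, |h ω| ≤ 1) {B : Set Ω}
    (hB : MeasurableSet[pathSigma X] B) {C : Fin n → Set ℝ≥0∞} (hC : ∀ i, MeasurableSet (C i)) :
    ∫ ω in B, h ω * (⋂ i, τ i ⁻¹' C i).indicator (fun _ => (1 : ℝ)) ω ∂μ =
      ∫ ω in B, h ω * ∏ i, μ[(τ i ⁻¹' C i).indicator (fun _ => (1 : ℝ)) | pathSigma X] ω ∂μ := by
  have hle := pathSigma_le hX
  have hI : Integrable ((⋂ i, τ i ⁻¹' C i).indicator fun _ => (1 : ℝ)) μ :=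
    (integrable_const 1).indicator (MeasurableSet.iInter fun i => hτ i (hC i))
  have hp := condExp_stronglyMeasurable_mul_of_bound hle hm.stronglyMeasurable hI (μ := μ) 1
    (Eventually.of_forall h1)
  have hint : Integrable (h * (⋂ i, τ i ⁻¹' C i).indicator fun _ => (1 : ℝ)) μ :=
    hI.bdd_mul (hm.mono hle le_rfl).aestronglyMeasurable (Eventually.of_forall h1)
  calc _ = ∫ ω in B, (μ[h * (⋂ i, τ i ⁻¹' C i).indicator fun _ => (1 : ℝ) | pathSigma X]) ω ∂μ :=
        (setIntegral_condExp hle hint hB).symm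
    _ = _ := by
        refine setIntegral_congr_ae (hle _ hB) ?_
        filter_upwards [hp, hci C hC] with ω e1 e2 _
        rw [e1, Pi.mul_apply, e2]

-- Both sides factor over the obligors. This brings survival products into the rectangular form to
-- which conditional independence applies.
omit hb hX hrc hτ hlam mΩ [IsProbabilityMeasure μ] in
lemma prod_survival_mul_indicator (A : Finset (Fin n)) (t : ℝ≥0) (C : Fin n → Set ℝ≥0∞) (ω : Ω) :
    (⋂ i, τ i ⁻¹' C i).indicator (fun _ => (1 : ℝ)) ω * ∏ i ∈ A, (1 - defaultInd τ i t ω) =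
      (⋂ i, τ i ⁻¹' (if i ∈ A then C i ∩ Set.Ioi (t : ℝ≥0∞) else C i)).indicator
        (fun _ => (1 : ℝ)) ω := by
  have h1 : ∀ (D : Fin n → Set ℝ≥0∞), (⋂ i, τ i ⁻¹' D i).indicator (fun _ => (1 : ℝ)) ω =
      ∏ i, (D i).indicator (fun _ => (1 : ℝ)) (τ i ω) := by
    intro D
    by_cases h : ω ∈ ⋂ i, τ i ⁻¹' D i
    · rw [Set.indicator_of_mem h]
      refine (Finset.prod_eq_one fun i _ => ?_).symm
      exact Set.indicator_of_mem (s := D i) (Set.mem_iInter.1 h i) _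
    · rw [Set.indicator_of_notMem h]
      rw [Set.mem_iInter, not_forall] at h
      obtain ⟨i, hi⟩ := h
      exact (Finset.prod_eq_zero (Finset.mem_univ i)
        (Set.indicator_of_notMem (s := D i) hi _)).symm
  have h2 : ∏ i ∈ A, (1 - defaultInd τ i t ω) =
      ∏ i, if i ∈ A then 1 - defaultInd τ i t ω else 1 := by
    rw [Finset.prod_ite_mem, Finset.univ_inter]
  rw [h1, h1, h2, ← Finset.prod_mul_distrib]
  refine Finset.prod_congr rfl fun i _ => ?_
  by_cases hi : i ∈ A
  · have := congrFun (one_sub_defaultInd_eq_indicator (τ := τ) i t) ω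
    simp only [hi, if_true, this]
    by_cases h2 : τ i ω ∈ C i <;> by_cases h3 : (t : ℝ≥0∞) < τ i ω <;> simp [Set.indicator, h2, h3]
  · simp [hi]

/-- The condition `hCs` says that `C i` cannot distinguish times after `s`, so `τ i ⁻¹' C i` is
observable by time `s`. Given the path, each obligor in `A` contributes one factor `e^{-∫_s^t λᵀX}`,
and conditional independence multiplies them. -/
lemma setIntegral_prod_survival_basic (hci : CondIndepTimes μ (pathSigma X) τ)
    (hS : ∀ i, HasConditionalSurvival μ lam X τ i) (A : Finset (Fin n)) {s t : ℝ≥0} (hst : s ≤ t)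
    {B : Set Ω} (hB : MeasurableSet[pathSigma X] B) {C : Fin n → Set ℝ≥0∞}
    (hC : ∀ i, MeasurableSet (C i)) (hCs : ∀ i x, (s : ℝ≥0∞) < x → (x ∈ C i ↔ ⊤ ∈ C i)) :
    ∫ ω in B ∩ ⋂ i, τ i ⁻¹' C i, ∏ i ∈ A, (1 - defaultInd τ i t ω) ∂μ =
      ∫ ω in B ∩ ⋂ i, τ i ⁻¹' C i,
        Real.exp (-(addFun lam X t ω - addFun lam X s ω)) ^ A.card *
          ∏ i ∈ A, (1 - defaultInd τ i s ω) ∂μ := by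
  have hle := pathSigma_le hX
  set E : Ω → ℝ := fun ω => Real.exp (-(addFun lam X t ω - addFun lam X s ω)) with hE
  have hEm : Measurable[pathSigma X] E := Real.measurable_exp.comp
    ((measurable_addFun hrc lam t fun r _ => measurable_pathSigma r).sub
      (measurable_addFun hrc lam s fun r _ => measurable_pathSigma r)).neg
  have hE1 : ∀ ω, |E ω| ≤ 1 := fun ω => by
    rw [abs_of_pos (Real.exp_pos _), Real.exp_le_one_iff]
    linarith [addFun_sub_nonneg hb hX hrc hlam ω hst]
  have hE1' : ∀ ω, |E ω ^ A.card| ≤ 1 := fun ω => by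
    rw [abs_pow]
    exact pow_le_one₀ (abs_nonneg _) (hE1 ω)
  have hCm : MeasurableSet (⋂ i, τ i ⁻¹' C i) := MeasurableSet.iInter fun i => hτ i (hC i)
  let D : ℝ≥0 → Fin n → Set ℝ≥0∞ := fun r i =>
    if i ∈ A then C i ∩ Set.Ioi (r : ℝ≥0∞) else C i
  have hD : ∀ r i, MeasurableSet (D r i) := fun r i => by
    by_cases h : i ∈ A
    · simpa [D, h] using (hC i).inter measurableSet_Ioi
    · simpa [D, h] using hC i
  have hsplit : ∀ g : Ω → ℝ, ∫ ω in B ∩ ⋂ i, τ i ⁻¹' C i, g ω ∂μ =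
      ∫ ω in B, (⋂ i, τ i ⁻¹' C i).indicator (fun _ => (1 : ℝ)) ω * g ω ∂μ := by
    intro g
    rw [← setIntegral_indicator hCm]
    congr 1
    ext ω
    by_cases h : ω ∈ ⋂ i, τ i ⁻¹' C i <;> simp only [Set.indicator, h] <;> simp
  -- For `i ∈ A` and `r ≥ s`, the set `D r i` is all of `(r, ∞]` or empty, according to whether `⊤ ∈
  -- C i`. The first case is `condExp_survival`; the second is trivial.
  have hcond : ∀ i, μ[(τ i ⁻¹' D t i).indicator (fun _ => (1 : ℝ)) | pathSigma X] =ᵐ[μ]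
      fun ω => (if i ∈ A then E ω else 1) *
        μ[(τ i ⁻¹' D s i).indicator (fun _ => (1 : ℝ)) | pathSigma X] ω := by
    intro i
    by_cases hi : i ∈ A
    · by_cases hT : ⊤ ∈ C i
      · have e : ∀ r, s ≤ r → D r i = Set.Ioi (r : ℝ≥0∞) := fun r hr => by
          simp only [D, hi, if_true]
          refine Set.inter_eq_right.2 fun x hx => (hCs i x ?_).2 hT
          exact lt_of_le_of_lt (ENNReal.coe_le_coe.2 hr) hx
        rw [e t hst, e s le_rfl, ← one_sub_defaultInd_eq_indicator,
          ← one_sub_defaultInd_eq_indicator]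
        simpa only [hi, if_true] using condExp_survival hb hX hrc hτ hlam (hS i) s t
      · have e : ∀ r, s ≤ r → D r i = ∅ := fun r hr => by
          simp only [D, hi, if_true]
          refine Set.eq_empty_of_forall_notMem fun x hx => hT ((hCs i x ?_).1 hx.1)
          exact lt_of_le_of_lt (ENNReal.coe_le_coe.2 hr) hx.2
        rw [e t hst, e s le_rfl, Set.preimage_empty, Set.indicator_empty]
        have e0 : μ[fun _ : Ω => (0 : ℝ) | pathSigma X] = 0 := condExp_zero
        rw [e0]
        exact Eventually.of_forall fun ω => by simp
    · have e : ∀ r, D r i = C i := fun r => by simp [D, hi]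
      rw [e, e]
      exact Eventually.of_forall fun ω => by simp [hi]
  change _ = ∫ ω in B ∩ ⋂ i, τ i ⁻¹' C i,
    E ω ^ A.card * ∏ i ∈ A, (1 - defaultInd τ i s ω) ∂μ
  rw [hsplit, hsplit]
  have e1 : ∀ ω, (⋂ i, τ i ⁻¹' C i).indicator (fun _ => (1 : ℝ)) ω *
      (E ω ^ A.card * ∏ i ∈ A, (1 - defaultInd τ i s ω)) =
      E ω ^ A.card * (⋂ i, τ i ⁻¹' D s i).indicator (fun _ => (1 : ℝ)) ω := by
    intro ω
    rw [← prod_survival_mul_indicator A s C ω]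
    ring
  have e2 : ∀ ω, (⋂ i, τ i ⁻¹' C i).indicator (fun _ => (1 : ℝ)) ω *
      ∏ i ∈ A, (1 - defaultInd τ i t ω) =
      1 * (⋂ i, τ i ⁻¹' D t i).indicator (fun _ => (1 : ℝ)) ω := by
    intro ω
    rw [prod_survival_mul_indicator A t C ω, one_mul]
  simp only [e1, e2]
  rw [setIntegral_mul_indicator_iInter (h := fun _ => 1) hX hτ hci measurable_const (by simp) hB
      (hD t), setIntegral_mul_indicator_iInter hX hτ hci (hEm.pow_const A.card) hE1' hB (hD s)]
  refine setIntegral_congr_ae (hle _ hB) ?_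
  filter_upwards [ae_all_iff.2 hcond] with ω hω _
  rw [one_mul, Finset.prod_congr rfl fun i _ => hω i, Finset.prod_mul_distrib]
  congr 1
  simp

end Projection

/-! ### The past up to `s` enlarged by the whole path, and the evolution of the blocks. -/

section Enlarged

variable {X : ℝ≥0 → Ω → Fin d → ℝ} {τ : Fin n → Ω → ℝ≥0∞}
  {μ : Measure Ω} [IsProbabilityMeasure μ] {lam : Fin d → ℝ} {Q : Matrix (Fin d) (Fin d) ℝ}

/-- The part of a time that is observable up to `s`. -/
def censor (s : ℝ≥0) (x : ℝ≥0∞) : ℝ≥0∞ := if x ≤ s then x else ⊤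

lemma measurable_censor (s : ℝ≥0) : Measurable (censor s) :=
  Measurable.ite measurableSet_Iic measurable_id measurable_const

/-- The path of the chain (index `none`) and the censored default times. -/
abbrev enlargedFamily (X : ℝ≥0 → Ω → Fin d → ℝ) (τ : Fin n → Ω → ℝ≥0∞) (s : ℝ≥0) :
    Option (Fin n) → MeasurableSpace Ω
  | none => pathSigma X
  | some i => MeasurableSpace.comap (fun ω => censor s (τ i ω)) inferInstance

/-- The `σ`-algebra of the past up to `s` enlarged by the whole path of the chain. -/
abbrev enlargedSigma (X : ℝ≥0 → Ω → Fin d → ℝ) (τ : Fin n → Ω → ℝ≥0∞) (s : ℝ≥0) :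
    MeasurableSpace Ω := ⨆ o, enlargedFamily X τ s o

omit mΩ in
lemma pathSigma_le_enlargedSigma (s : ℝ≥0) : pathSigma X ≤ enlargedSigma X τ s :=
  le_iSup (enlargedFamily X τ s) none

omit mΩ in
lemma measurable_enlargedSigma_defaultInd (i : Fin n) {r s : ℝ≥0} (hrs : r ≤ s) :
    Measurable[enlargedSigma X τ s] (defaultInd τ i r) := by
  have h1 : Measurable[enlargedSigma X τ s] fun ω => censor s (τ i ω) :=
    Measurable.mono (comap_measurable _) (le_iSup (enlargedFamily X τ s) (some i)) le_rfl
  have h2 : Measurable fun x : ℝ≥0∞ => if x ≤ r then (1 : ℝ) else 0 :=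
    Measurable.ite measurableSet_Iic measurable_const measurable_const
  have h3 : defaultInd τ i r = fun ω => if censor s (τ i ω) ≤ r then (1 : ℝ) else 0 := by
    ext ω
    have hrs' : (r : ℝ≥0∞) ≤ s := ENNReal.coe_le_coe.2 hrs
    by_cases h : τ i ω ≤ s
    · simp [defaultInd, censor, h]
    · have h4 : ¬ τ i ω ≤ r := fun h5 => h (h5.trans hrs')
      simp [defaultInd, censor, h, h4]
  rw [h3]
  exact h2.comp h1

variable (hb : ∀ t ω, ∃ k : Fin d, X t ω = Pi.single k 1) (hX : ∀ t, Measurable (X t))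
  (hrc : ∀ ω r, ContinuousWithinAt (fun r => X r ω) (Set.Ici r) r)
  (hτ : ∀ i, Measurable (τ i)) (hlam : ∀ j, 0 ≤ lam j)

include hX hτ in
lemma enlargedSigma_le (s : ℝ≥0) : enlargedSigma X τ s ≤ mΩ := by
  refine iSup_le fun o => ?_
  cases o with
  | none => exact pathSigma_le hX
  | some i => exact ((measurable_censor s).comp (hτ i)).comap_le

lemma fullFiltration_le_enlargedSigma (s : ℝ≥0) :
    fullFiltration X τ hX hτ s ≤ enlargedSigma X τ s :=
  fullFiltration_le (mΩ := mΩ) hX hτ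
    (fun r _ => (measurable_pathSigma r).mono (pathSigma_le_enlargedSigma s) le_rfl)
    (fun i _ hr => measurable_enlargedSigma_defaultInd i hr)

include hb hX hrc hτ hlam

/-- The rectangles of path events and events of censored times form a generating π-system. Censoring
sends all times after `s` to `⊤`, which is exactly the condition `hCs` of the rectangle case. -/
lemma setIntegral_prod_survival (hci : CondIndepTimes μ (pathSigma X) τ)
    (hS : ∀ i, HasConditionalSurvival μ lam X τ i) (A : Finset (Fin n)) {s t : ℝ≥0} (hst : s ≤ t)
    {G : Set Ω} (hG : MeasurableSet[enlargedSigma X τ s] G) :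
    ∫ ω in G, ∏ i ∈ A, (1 - defaultInd τ i t ω) ∂μ =
      ∫ ω in G, Real.exp (-(addFun lam X t ω - addFun lam X s ω)) ^ A.card *
          ∏ i ∈ A, (1 - defaultInd τ i s ω) ∂μ := by
  classical
  have bP : ∀ r, BddMeas fun ω => ∏ i ∈ A, (1 - defaultInd τ i r ω) := fun r =>
    .prod fun i _ => bddMeas_one_sub_defaultInd hτ i r
  have bE : BddMeas fun ω => Real.exp (-(addFun lam X t ω - addFun lam X s ω)) ^ A.card := by
    refine .of_le (C := 1) ((Real.measurable_exp.comp ((measurable_addFun_ambient hX hrc lam t).sub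
      (measurable_addFun_ambient hX hrc lam s)).neg).pow_const _) fun ω => ?_
    rw [abs_pow]
    refine pow_le_one₀ (abs_nonneg _) ?_
    rw [abs_of_pos (Real.exp_pos _), Real.exp_le_one_iff]
    linarith [addFun_sub_nonneg hb hX hrc hlam ω hst]
  have hgen : enlargedSigma X τ s = MeasurableSpace.generateFrom
      (piiUnionInter (fun o => {S | MeasurableSet[enlargedFamily X τ s o] S}) Set.univ) := by
    rw [generateFrom_piiUnionInter_measurableSet (enlargedFamily X τ s)]
    simp [enlargedSigma]
  have hbasic := fun (B : Set Ω) (hB : MeasurableSet[pathSigma X] B) (C : Fin n → Set ℝ≥0∞)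
    (hC : ∀ i, MeasurableSet (C i)) (hCs : ∀ i x, (s : ℝ≥0∞) < x → (x ∈ C i ↔ ⊤ ∈ C i)) =>
    setIntegral_prod_survival_basic (μ := μ) hb hX hrc hτ hlam hci hS A hst hB hC hCs
  refine setIntegral_eq_of_piSystem (enlargedSigma_le hX hτ s) hgen
    (isPiSystem_piiUnionInter _ (fun o => @MeasurableSpace.isPiSystem_measurableSet _
      (enlargedFamily X τ s o)) _) (bP t).integrable (bE.mul (bP s)).integrable ?_ ?_ G hG
  · simpa using hbasic Set.univ .univ (fun _ => Set.univ) (fun _ => .univ) (by simp)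
  · rintro G ⟨S, -, f, hf, rfl⟩
    -- Obligors that do not occur in the rectangle receive the trivial event, so that the
    -- intersection runs over all of `Fin n`.
    have hD : ∀ i, ∃ D : Set ℝ≥0∞, MeasurableSet D ∧
        (if some i ∈ S then f (some i) else Set.univ) = (fun ω => censor s (τ i ω)) ⁻¹' D := by
      intro i
      by_cases h : some i ∈ S
      · obtain ⟨D, hD, hDf⟩ := hf _ h
        exact ⟨D, hD, by rw [if_pos h, hDf]⟩
      · exact ⟨Set.univ, .univ, by simp [h]⟩
    choose D hDm hDf using hD
    have hset : (⋂ o ∈ S, f o) = (if none ∈ S then f none else Set.univ) ∩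
        ⋂ i, τ i ⁻¹' (censor s ⁻¹' D i) := by
      have h1 : ∀ i, τ i ⁻¹' (censor s ⁻¹' D i) =
          if some i ∈ S then f (some i) else Set.univ := fun i => (hDf i).symm
      simp only [h1]
      ext ω
      simp only [Set.mem_iInter, Set.mem_inter_iff]
      constructor
      · intro h
        refine ⟨?_, fun i => ?_⟩
        · by_cases h2 : none ∈ S
          · simpa [h2] using h _ h2
          · simp [h2]
        · by_cases h2 : some i ∈ S
          · simpa [h2] using h _ h2
          · simp [h2]
      · rintro ⟨h2, h3⟩ o ho
        cases o with
        | none => simpa [ho] using h2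
        | some i => simpa [ho] using h3 i
    rw [hset]
    refine hbasic _ ?_ _ (fun i => measurable_censor s (hDm i)) fun i x hx => ?_
    · by_cases h : none ∈ S
      · rw [if_pos h]
        exact hf _ h
      · rw [if_neg h]
        exact .univ
    · simp [censor, not_le.2 hx]

omit hb hX hrc hτ hlam mΩ in
lemma addFun_smul (c : ℝ) (t : ℝ≥0) (ω : Ω) : addFun (c • lam) X t ω = c * addFun lam X t ω := by
  simp only [addFun, smul_dotProduct, smul_eq_mul]
  exact intervalIntegral.integral_const_mul _ _

-- Both sides are linear in the weight, so it may be rescaled into `[-1, 1]`. This is needed for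
-- weights containing `e^{+∫_0^s vᵀX}`.
omit hτ in
lemma integral_path_mul_exp_addFun_of_bddMeas {𝔾 : Filtration ℝ≥0 mΩ}
    (hXa : ∀ t, Measurable[𝔾 t] (X t)) (hQ : SolvesMartingaleProblem μ Q X 𝔾)
    {s t : ℝ≥0} (hst : s ≤ t) {W : Ω → ℝ} (hW : Measurable[𝔾 s] W) (bW : BddMeas W) :
    (fun l => ∫ ω, W ω * (X t ω l * Real.exp (-addFun lam X t ω)) ∂μ) =
      NormedSpace.exp (((t : ℝ) - s) • (Q - Matrix.diagonal lam)) *ᵥ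
        fun l => ∫ ω, W ω * (X s ω l * Real.exp (-addFun lam X s ω)) ∂μ := by
  obtain ⟨C, hC⟩ := bW.2
  have hC' : 0 < |C| + 1 := by positivity
  set c : ℝ := (|C| + 1)⁻¹ with hc
  have hc0 : 0 < c := inv_pos.2 hC'
  have h := integral_path_mul_exp_addFun (μ := μ) hb hX hrc hXa hQ hlam hst
    (W := fun ω => c * W ω) (hW.const_mul c) fun ω => by
      rw [abs_mul, abs_of_pos hc0, hc, inv_mul_le_iff₀ hC', mul_one]
      linarith [hC ω, le_abs_self C]
  have e : ∀ r, (fun l => ∫ ω, c * W ω * (X r ω l * Real.exp (-addFun lam X r ω)) ∂μ) =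
      c • fun l => ∫ ω, W ω * (X r ω l * Real.exp (-addFun lam X r ω)) ∂μ := by
    intro r
    ext l
    rw [Pi.smul_apply, smul_eq_mul, ← integral_const_mul]
    simp only [mul_assoc]
  rw [e, e, Matrix.mulVec_smul] at h
  exact smul_right_injective _ hc0.ne' h

/-- The block `X ∏ (1 - Y^i)` of the joint process has the generator `Q - |A| diag λ`. -/
lemma setIntegral_path_mul_prod_survival (hci : CondIndepTimes μ (pathSigma X) τ)
    (hS : ∀ i, HasConditionalSurvival μ lam X τ i)
    (hQ : SolvesMartingaleProblem μ Q X (fullFiltration X τ hX hτ))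
    (A : Finset (Fin n)) {s t : ℝ≥0} (hst : s ≤ t)
    {G : Set Ω} (hG : MeasurableSet[fullFiltration X τ hX hτ s] G) (l : Fin d) :
    ∫ ω in G, X t ω l * ∏ i ∈ A, (1 - defaultInd τ i t ω) ∂μ =
      ∫ ω in G, (NormedSpace.exp (((t : ℝ) - s) • killedGen Q lam A.card) *ᵥ X s ω) l *
        ∏ i ∈ A, (1 - defaultInd τ i s ω) ∂μ := by
  have hGm : MeasurableSet G := (fullFiltration X τ hX hτ).le s _ hG
  have bP : ∀ r, BddMeas fun ω => ∏ i ∈ A, (1 - defaultInd τ i r ω) := fun r =>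
    .prod fun i _ => bddMeas_one_sub_defaultInd hτ i r
  have bX := bddMeas_path hb hX
  have bG : BddMeas (G.indicator fun _ => (1 : ℝ)) :=
    .of_le (C := 1) (measurable_const.indicator hGm) fun ω => by
      by_cases h : ω ∈ G <;> simp [h]
  set v : Fin d → ℝ := (A.card : ℝ) • lam with hv
  have hv0 : ∀ i, 0 ≤ v i := fun i => mul_nonneg (Nat.cast_nonneg _) (hlam i)
  set K := Q - Matrix.diagonal v with hK
  have hKk : killedGen Q lam A.card = K := by
    rw [killedGen, hK, hv]
    congr 1
    rw [← Matrix.diagonal_smul]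
  have hind : ∀ g : Ω → ℝ, ∫ ω in G, g ω ∂μ = ∫ ω, G.indicator (fun _ => (1 : ℝ)) ω * g ω ∂μ := by
    intro g
    rw [← integral_indicator hGm]
    congr 1
    ext ω
    by_cases h : ω ∈ G <;> simp [h]
  -- The enlarged `σ`-algebra contains the future of the chain, so `{X_t = e_l}` may be intersected
  -- with `G` before the survival formula is applied.
  have step1 : ∫ ω in G, X t ω l * ∏ i ∈ A, (1 - defaultInd τ i t ω) ∂μ =
      ∫ ω in G, X t ω l * (Real.exp (-(addFun lam X t ω - addFun lam X s ω)) ^ A.card *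
        ∏ i ∈ A, (1 - defaultInd τ i s ω)) ∂μ := by
    have hev : MeasurableSet[pathSigma X] {ω | X t ω l = 1} :=
      ((measurable_pi_apply l).comp (measurable_pathSigma t)) (measurableSet_singleton 1)
    have h1 := setIntegral_prod_survival (μ := μ) hb hX hrc hτ hlam hci hS A hst
      (G := G ∩ {ω | X t ω l = 1})
      (MeasurableSet.inter (fullFiltration_le_enlargedSigma hX hτ s _ hG)
        (pathSigma_le_enlargedSigma s _ hev))
    have h2 : ∀ g : Ω → ℝ, ∫ ω in G ∩ {ω | X t ω l = 1}, g ω ∂μ =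
        ∫ ω in G, X t ω l * g ω ∂μ := by
      intro g
      rw [← setIntegral_indicator (pathSigma_le hX _ hev)]
      congr 1
      ext ω
      rcases path_zero_or_one hb t ω l with h | h <;> simp [Set.indicator, h]
    rwa [h2, h2] at h1
  have bAs : BddMeas fun ω => Real.exp (addFun v X s ω) := by
    refine .of_le (C := Real.exp ((∑ j, |v j|) * s)) (Real.measurable_exp.comp
      (measurable_addFun_ambient hX hrc v s)) fun ω => ?_
    rw [abs_of_pos (Real.exp_pos _)]
    refine Real.exp_le_exp.2 ?_
    have := abs_addFun_sub_le hb hX hrc v (zero_le (a := s)) ω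
    have h0 : addFun v X 0 ω = 0 := by simp [addFun]
    rw [h0, sub_zero, NNReal.coe_zero, sub_zero] at this
    exact (le_abs_self _).trans this
  -- The factor `e^{∫_0^s vᵀX}` is known at time `s`; it turns the discount from 0 to `t` into the
  -- one from `s` to `t` and cancels the discount at `s`.
  let W : Ω → ℝ := fun ω => G.indicator (fun _ => (1 : ℝ)) ω *
    ((∏ i ∈ A, (1 - defaultInd τ i s ω)) * Real.exp (addFun v X s ω))
  have bW : BddMeas W := bG.mul ((bP s).mul bAs)
  have hWm : Measurable[fullFiltration X τ hX hτ s] W := by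
    refine (measurable_const.indicator hG).mul (Measurable.mul ?_ ?_)
    · exact Finset.measurable_prod _ fun i _ => (measurable_full_default hX hτ i s).const_sub 1
    · exact Real.measurable_exp.comp (measurable_addFun hrc v s fun r hr =>
        (measurable_full_path hX hτ r).mono ((fullFiltration X τ hX hτ).mono hr) le_rfl)
  have step2 := congrFun (integral_path_mul_exp_addFun_of_bddMeas (μ := μ) hb hX hrc hv0
    (measurable_full_path hX hτ) hQ hst hWm bW) l
  have e1 : ∀ ω, G.indicator (fun _ => (1 : ℝ)) ω * (X t ω l *
      (Real.exp (-(addFun lam X t ω - addFun lam X s ω)) ^ A.card *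
        ∏ i ∈ A, (1 - defaultInd τ i s ω))) =
      W ω * (X t ω l * Real.exp (-addFun v X t ω)) := by
    intro ω
    have : Real.exp (-(addFun lam X t ω - addFun lam X s ω)) ^ A.card =
        Real.exp (addFun v X s ω) * Real.exp (-addFun v X t ω) := by
      rw [← Real.exp_nat_mul, ← Real.exp_add, hv, addFun_smul, addFun_smul]
      ring_nf
    rw [this]
    simp only [W]
    ring
  have e2 : ∀ j ω, W ω * (X s ω j * Real.exp (-addFun v X s ω)) =
      G.indicator (fun _ => (1 : ℝ)) ω * (X s ω j * ∏ i ∈ A, (1 - defaultInd τ i s ω)) := by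
    intro j ω
    have : Real.exp (addFun v X s ω) * Real.exp (-addFun v X s ω) = 1 := by
      rw [← Real.exp_add, add_neg_cancel, Real.exp_zero]
    simp only [W]
    linear_combination (G.indicator (fun _ => (1 : ℝ)) ω * X s ω j *
      ∏ i ∈ A, (1 - defaultInd τ i s ω)) * this
  rw [step1, hind, hKk]
  simp only [e1]
  rw [step2, hind, Matrix.mulVec, dotProduct]
  simp only [e2, ← integral_const_mul]
  rw [← integral_finsetSum _ fun j _ =>
    ((BddMeas.const _).mul (bG.mul ((bX s j).mul (bP s)))).integrable]
  congr 1
  ext ω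
  simp only [Matrix.mulVec, dotProduct, Finset.sum_mul, Finset.mul_sum]
  exact Finset.sum_congr rfl fun j _ => by ring

end Enlarged

/-! ### Expansion over sets of survivors. -/

section Combinatorics

variable {τ : Fin n → Ω → ℝ≥0∞}

omit mΩ

/-- The coefficient of a set of surviving obligors in the expansion of `e^{iuN}`. -/
def subsetCoeff (n : ℕ) (u : ℝ) (m : ℕ) : ℂ :=
  (1 - Complex.exp (Complex.I * u)) ^ m * Complex.exp (Complex.I * u) ^ (n - m)

/-- Each factor is affine in the survival indicator, `e^{iuY} = (1 - e^{iu})(1 - Y) + e^{iu}`, and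
the product of such binomials expands over subsets. -/
lemma exp_numDefaults_eq_sum (u : ℝ) (t : ℝ≥0) (ω : Ω) :
    Complex.exp (Complex.I * u * (numDefaults τ t ω : ℂ)) =
      ∑ A : Finset (Fin n), subsetCoeff n u A.card *
        ((∏ i ∈ A, (1 - defaultInd τ i t ω) : ℝ) : ℂ) := by
  have h1 : ∀ i, Complex.exp (Complex.I * u * (defaultInd τ i t ω : ℂ)) =
      (1 - Complex.exp (Complex.I * u)) * ((1 - defaultInd τ i t ω : ℝ) : ℂ) +
        Complex.exp (Complex.I * u) := by
    intro i
    rcases defaultInd_zero_or_one (τ := τ) i t ω with h | h <;> simp [h]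
  rw [numDefaults, Complex.ofReal_sum, Finset.mul_sum, Complex.exp_sum,
    Finset.prod_congr rfl fun i _ => h1 i, Fintype.prod_add]
  refine Finset.sum_congr rfl fun A _ => ?_
  rw [Finset.prod_mul_distrib, Finset.prod_const, Finset.prod_const, Finset.card_compl,
    Fintype.card_fin, subsetCoeff, Complex.ofReal_prod]
  ring

/-- The obligors that have not defaulted at time `t`. -/
def survivors (τ : Fin n → Ω → ℝ≥0∞) (t : ℝ≥0) (ω : Ω) : Finset (Fin n) := by
  classical exact Finset.univ.filter fun i => ¬ τ i ω ≤ t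

lemma prod_one_sub_defaultInd (A : Finset (Fin n)) (t : ℝ≥0) (ω : Ω) :
    ∏ i ∈ A, (1 - defaultInd τ i t ω) = if A ⊆ survivors τ t ω then 1 else 0 := by
  classical
  split_ifs with h
  · refine Finset.prod_eq_one fun i hi => ?_
    have := h hi
    rw [survivors, Finset.mem_filter] at this
    simp [defaultInd, this.2]
  · obtain ⟨i, hi, hi2⟩ := Finset.not_subset.1 h
    refine Finset.prod_eq_zero hi ?_
    have : τ i ω ≤ t := by
      by_contra h3
      exact hi2 (by rw [survivors]; simpa using h3)
    simp [defaultInd, this]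

lemma numDefaults_eq (t : ℝ≥0) (ω : Ω) :
    numDefaults τ t ω = ((n - (survivors τ t ω).card : ℕ) : ℝ) := by
  classical
  have h1 : ∀ i, defaultInd τ i t ω = 1 - if i ∈ survivors τ t ω then (1 : ℝ) else 0 := by
    intro i
    by_cases h : τ i ω ≤ t
    · simp [defaultInd, survivors, h, not_lt.2 h]
    · simp [defaultInd, survivors, h, not_le.1 h]
  have h2 : (survivors τ t ω).card ≤ n := by
    simpa using Finset.card_le_univ (survivors τ t ω)
  rw [numDefaults, Finset.sum_congr rfl fun i _ => h1 i, Finset.sum_sub_distrib, Nat.cast_sub h2]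
  simp

/-- The expansion over subsets of survivors, collected by the number of defaults. -/
lemma sum_subsets_eq_sum_blocks {X : ℝ≥0 → Ω → Fin d → ℝ} (u : ℝ) (s : ℝ≥0) (ω : Ω)
    (y : ℕ → (Fin d → ℝ) → ℝ) (hy : ∀ m, y m 0 = 0) :
    ∑ k ∈ Finset.range (n + 1), ∑ j ∈ Finset.Icc k n,
      ((n - k).choose (j - k) : ℂ) * (1 - Complex.exp (Complex.I * u)) ^ (n - j) *
        Complex.exp (Complex.I * u * (j : ℂ)) * (y (n - j) (zetaBlock X τ k s ω) : ℂ) =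
    ∑ A : Finset (Fin n), subsetCoeff n u A.card *
      ((y A.card (X s ω) * ∏ i ∈ A, (1 - defaultInd τ i s ω) : ℝ) : ℂ) := by
  classical
  set S := survivors τ s ω with hS
  set p := S.card with hp
  have hpn : p ≤ n := by simpa using Finset.card_le_univ S
  have hN : numDefaults τ s ω = ((n - p : ℕ) : ℝ) := numDefaults_eq s ω
  -- With `p` survivors, every block except `k = n - p` vanishes, and `hy` removes its term.
  rw [Finset.sum_eq_single (n - p)]
  · have hR : ∑ A : Finset (Fin n), subsetCoeff n u A.card *
        ((y A.card (X s ω) * ∏ i ∈ A, (1 - defaultInd τ i s ω) : ℝ) : ℂ) =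
        ∑ A ∈ S.powerset, subsetCoeff n u A.card * (y A.card (X s ω) : ℂ) := by
      rw [← Finset.sum_subset (Finset.subset_univ S.powerset)]
      · refine Finset.sum_congr rfl fun A hA => ?_
        rw [prod_one_sub_defaultInd, if_pos (Finset.mem_powerset.1 hA), mul_one]
      · intro A _ hA
        rw [prod_one_sub_defaultInd, if_neg (fun h => hA (Finset.mem_powerset.2 h))]
        simp
    rw [hR, Finset.sum_powerset_apply_card (fun m => subsetCoeff n u m * (y m (X s ω) : ℂ)), ← hp]
    -- The index `j` corresponds to sets of size `n - j`, of which the `p = n - k` survivors have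
    -- `C(p, n-j) = C(n-k, j-k)`.
    refine Finset.sum_bij' (fun j _ => n - j) (fun m _ => n - m) ?_ ?_ ?_ ?_ ?_
    · intro j hj
      rw [Finset.mem_Icc] at hj
      rw [Finset.mem_range]
      omega
    · intro m hm
      rw [Finset.mem_range] at hm
      rw [Finset.mem_Icc]
      omega
    · intro j hj
      rw [Finset.mem_Icc] at hj
      omega
    · intro m hm
      rw [Finset.mem_range] at hm
      omega
    · intro j hj
      rw [Finset.mem_Icc] at hj
      have e1 : n - (n - p) = p := by omega
      have e2 : j - (n - p) = p - (n - j) := by omega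
      have e3 : n - (n - j) = j := by omega
      have e4 : Complex.exp (Complex.I * u * (j : ℂ)) = Complex.exp (Complex.I * u) ^ j := by
        rw [← Complex.exp_nat_mul]
        ring_nf
      rw [e1, e2, Nat.choose_symm (by omega), subsetCoeff, e3, e4, zetaBlock, if_pos hN,
        nsmul_eq_mul]
      ring
  · intro k _ hk
    refine Finset.sum_eq_zero fun j _ => ?_
    have : zetaBlock X τ k s ω = 0 := by
      rw [zetaBlock, if_neg]
      rw [hN]
      exact fun h => hk (by exact_mod_cast h.symm)
    rw [this, hy]
    simp
  · intro h
    exact absurd (Finset.mem_range.2 (by omega)) h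

end Combinatorics

/-! ### Complex and vector-valued conditional expectations; assembly. -/

section CondExp

variable {μ : Measure Ω} [IsProbabilityMeasure μ]

lemma integrable_sum_ofReal {ι : Type*} [Fintype ι] (c : ι → ℂ) {f : ι → Ω → ℝ}
    (hf : ∀ a, BddMeas (f a)) : Integrable (fun ω => ∑ a, c a * (f a ω : ℂ)) μ :=
  integrable_finsetSum _ fun a _ => ((hf a).integrable.ofReal).const_mul _

lemma setIntegral_sum_ofReal_congr {ι : Type*} [Fintype ι] (c : ι → ℂ) {f g : ι → Ω → ℝ}
    (hf : ∀ a, BddMeas (f a)) (hg : ∀ a, BddMeas (g a)) {G : Set Ω}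
    (h : ∀ a, ∫ ω in G, f a ω ∂μ = ∫ ω in G, g a ω ∂μ) :
    ∫ ω in G, ∑ a, c a * (f a ω : ℂ) ∂μ = ∫ ω in G, ∑ a, c a * (g a ω : ℂ) ∂μ := by
  have hi : ∀ {f : ι → Ω → ℝ}, (∀ a, BddMeas (f a)) → ∀ a ∈ Finset.univ,
      Integrable (fun ω => c a * (f a ω : ℂ)) (μ.restrict G) := fun hf a _ =>
    ((hf a).integrable.ofReal.const_mul (c a)).integrableOn
  rw [integral_finsetSum _ (hi hf), integral_finsetSum _ (hi hg)]
  refine Finset.sum_congr rfl fun a _ => ?_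
  rw [integral_const_mul, integral_const_mul]
  congr 1
  have e1 : ∫ ω in G, (f a ω : ℂ) ∂μ = ((∫ ω in G, f a ω ∂μ : ℝ) : ℂ) := integral_ofReal
  have e2 : ∫ ω in G, (g a ω : ℂ) ∂μ = ((∫ ω in G, g a ω ∂μ : ℝ) : ℂ) := integral_ofReal
  rw [e1, e2, h a]

end CondExp

/-- The regression formula for the blocks of an obligor model. -/
lemma IsObligorModel.setIntegral_path_mul_prod_survival {μ : Measure Ω} [IsProbabilityMeasure μ]
    {Q : Matrix (Fin d) (Fin d) ℝ} {lam : Fin d → ℝ} (hlam : ∀ i, 0 ≤ lam i)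
    {X : ℝ≥0 → Ω → Fin d → ℝ} {τ : Fin n → Ω → ℝ≥0∞}
    {hX : ∀ t, Measurable (X t)} {hτ : ∀ i, Measurable (τ i)}
    (hmodel : IsObligorModel μ Q lam X τ hX hτ) (A : Finset (Fin n)) {s t : ℝ≥0} (hst : s ≤ t)
    {G : Set Ω} (hG : MeasurableSet[fullFiltration X τ hX hτ s] G) (l : Fin d) :
    ∫ ω in G, X t ω l * ∏ i ∈ A, (1 - defaultInd τ i t ω) ∂μ =
      ∫ ω in G, (NormedSpace.exp (((t : ℝ) - s) • killedGen Q lam A.card) *ᵥ X s ω) l *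
        ∏ i ∈ A, (1 - defaultInd τ i s ω) ∂μ := by
  have hb := hmodel.basis_valued
  have hrc := hmodel.right_continuous
  have hQ : SolvesMartingaleProblem μ Q X (fullFiltration X τ hX hτ) :=
    solvesMartingaleProblem_of_martingale hb hX hrc hmodel.chain_martingale
  refine MarkovModulated.setIntegral_path_mul_prod_survival hb hX hrc hτ hlam hmodel.condIndep
    (fun i T G hG => ?_) hQ A hst hG l
  -- The single-obligor argument runs in the filtration of obligor `i`, where the default martingale
  -- is given; the chain property is restricted to it.
  exact setIntegral_survival (𝔾 := obligorFiltration X τ hX hτ i) hb hX hrc hτ hlam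
    (fun t => measurable_fst.comp (measurable_obligor_pair hX hτ i t))
    (fun t => measurable_snd.comp (measurable_obligor_pair hX hτ i t))
    (hQ.mono (obligorFiltration_le_fullFiltration hX hτ i))
    (hasDefaultIntensity_of_martingale hb hX hrc hτ (hmodel.default_martingale i))
    hmodel.left_limits (hmodel.no_common_jumps i) T hG

/-- The expansion of the conditional expectation over sets of surviving obligors. -/
lemma condExp_sum_ofReal_eq {μ : Measure Ω} [IsProbabilityMeasure μ] {m : MeasurableSpace Ω}
    (hle : m ≤ mΩ) {ι : Type*} [Fintype ι] (c : ι → ℂ) {f g : ι → Ω → ℝ}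
    (hf : ∀ a, BddMeas (mΩ := mΩ) (f a)) (hg : ∀ a, BddMeas (mΩ := mΩ) (g a))
    (hgm : ∀ a, Measurable[m] (g a))
    (h : ∀ a G, MeasurableSet[m] G → ∫ ω in G, f a ω ∂μ = ∫ ω in G, g a ω ∂μ) :
    μ[fun ω => ∑ a, c a * (f a ω : ℂ) | m] =ᵐ[μ] fun ω => ∑ a, c a * (g a ω : ℂ) := by
  refine (ae_eq_condExp_of_forall_setIntegral_eq hle (integrable_sum_ofReal (mΩ := mΩ) c hf)
    (fun G _ _ => (integrable_sum_ofReal (mΩ := mΩ) c hg).integrableOn)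
    (fun G hG _ => setIntegral_sum_ofReal_congr (mΩ := mΩ) c hg hf fun a => (h a G hG).symm) ?_).symm
  refine (Measurable.stronglyMeasurable ?_).aestronglyMeasurable
  exact Finset.measurable_sum _ fun a _ => (Complex.measurable_ofReal.comp (hgm a)).const_mul _

lemma condExp_pi_eq {μ : Measure Ω} {m : MeasurableSpace Ω} {f g : Ω → Fin d → ℂ}
    (hf : ∀ l, Integrable (fun ω => f ω l) μ)
    (h : ∀ l, μ[fun ω => f ω l | m] =ᵐ[μ] fun ω => g ω l) : μ[f | m] =ᵐ[μ] g := by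
  have h1 := fun l => (ContinuousLinearMap.proj (R := ℝ) (φ := fun _ : Fin d => ℂ) l).comp_condExp_comm
    (m := m) (Integrable.of_eval hf)
  filter_upwards [ae_all_iff.2 h1, ae_all_iff.2 h] with ω e1 e2
  ext l
  exact (e1 l).trans (e2 l)

end MarkovModulated

end

open MarkovModulated in
theorem mainTheorem6 {Ω : Type*} [mΩ : MeasurableSpace Ω] (μ : Measure Ω) [IsProbabilityMeasure μ]
    (n d : ℕ) (Q : Matrix (Fin d) (Fin d) ℝ) (hQ : MarkovModulated.IsIntensityMatrix Q)
    (lam : Fin d → ℝ) (hlam : ∀ i, 0 ≤ lam i)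
    (X : ℝ≥0 → Ω → Fin d → ℝ) (τ : Fin n → Ω → ℝ≥0∞)
    (hX : ∀ t, Measurable (X t)) (hτ : ∀ i, Measurable (τ i))
    (hmodel : MarkovModulated.IsObligorModel μ Q lam X τ hX hτ)
    (u : ℝ) (s t : ℝ≥0) (hst : s ≤ t) :
    (μ[fun ω => fun l : Fin d =>
          Complex.exp (Complex.I * u * (MarkovModulated.numDefaults τ t ω : ℂ)) * (X t ω l : ℂ)
        | MarkovModulated.fullFiltration X τ hX hτ s]
      =ᵐ[μ] fun ω => fun l : Fin d =>
        ∑ k ∈ Finset.range (n + 1), ∑ j ∈ Finset.Icc k n,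
          ((n - k).choose (j - k) : ℂ) * (1 - Complex.exp (Complex.I * u)) ^ (n - j) *
            Complex.exp (Complex.I * u * (j : ℂ)) *
            (((NormedSpace.exp (((t : ℝ) - (s : ℝ)) • MarkovModulated.killedGen Q lam (n - j)) *ᵥ
              MarkovModulated.zetaBlock X τ k s ω) l : ℝ) : ℂ)) ∧
    (μ[fun ω => Complex.exp (Complex.I * u * (MarkovModulated.numDefaults τ t ω : ℂ))
        | MarkovModulated.fullFiltration X τ hX hτ s]
      =ᵐ[μ] fun ω =>
        ∑ k ∈ Finset.range (n + 1), ∑ j ∈ Finset.Icc k n,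
          ((n - k).choose (j - k) : ℂ) * (1 - Complex.exp (Complex.I * u)) ^ (n - j) *
            Complex.exp (Complex.I * u * (j : ℂ)) *
            (((1 : Fin d → ℝ) ⬝ᵥ
              (NormedSpace.exp (((t : ℝ) - (s : ℝ)) • MarkovModulated.killedGen Q lam (n - j)) *ᵥ
                MarkovModulated.zetaBlock X τ k s ω) : ℝ) : ℂ)) := by
  have hb := hmodel.basis_valued
  have hle := (fullFiltration X τ hX hτ).le s
  have bX := bddMeas_path hb hX
  have bP : ∀ (A : Finset (Fin n)) r, BddMeas fun ω => ∏ i ∈ A, (1 - defaultInd τ i r ω) :=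
    fun A r => .prod fun i _ => bddMeas_one_sub_defaultInd hτ i r
  let E : ℕ → Matrix (Fin d) (Fin d) ℝ := fun m =>
    NormedSpace.exp (((t : ℝ) - (s : ℝ)) • killedGen Q lam m)
  have bE : ∀ m l, BddMeas fun ω => (E m *ᵥ X s ω) l := fun m l =>
    bddMeas_dotProduct hb hX (E m l) s
  have key : ∀ (A : Finset (Fin n)) (l : Fin d) (G : Set Ω),
      MeasurableSet[fullFiltration X τ hX hτ s] G →
      ∫ ω in G, X t ω l * ∏ i ∈ A, (1 - defaultInd τ i t ω) ∂μ =
        ∫ ω in G, (E A.card *ᵥ X s ω) l * ∏ i ∈ A, (1 - defaultInd τ i s ω) ∂μ :=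
    fun A l G hG => hmodel.setIntegral_path_mul_prod_survival hlam A hst hG l
  have mE : ∀ m l, Measurable[fullFiltration X τ hX hτ s] fun ω => (E m *ᵥ X s ω) l :=
    fun m l => measurable_dotProduct (measurable_full_path hX hτ s) (E m l)
  have mP : ∀ A : Finset (Fin n), Measurable[fullFiltration X τ hX hτ s]
      fun ω => ∏ i ∈ A, (1 - defaultInd τ i s ω) := fun A =>
    Finset.measurable_prod _ fun i _ => (measurable_full_default hX hτ i s).const_sub 1
  have bS : ∀ m, BddMeas fun ω => (1 : Fin d → ℝ) ⬝ᵥ (E m *ᵥ X s ω) := fun m => by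
    simp only [one_dotProduct]
    exact .sum fun l _ => bE m l
  have mS : ∀ m, Measurable[fullFiltration X τ hX hτ s]
      fun ω => (1 : Fin d → ℝ) ⬝ᵥ (E m *ᵥ X s ω) := fun m => by
    simp only [one_dotProduct]
    exact Finset.measurable_sum _ fun l _ => mE m l
  have hL : ∀ ω l, Complex.exp (Complex.I * u * (numDefaults τ t ω : ℂ)) * (X t ω l : ℂ) =
      ∑ A : Finset (Fin n), subsetCoeff n u A.card *
        ((X t ω l * ∏ i ∈ A, (1 - defaultInd τ i t ω) : ℝ) : ℂ) := fun ω l => by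
    rw [exp_numDefaults_eq_sum, Finset.sum_mul]
    refine Finset.sum_congr rfl fun A _ => ?_
    push_cast
    ring
  -- The scalar formula is the sum of the vector formula over its coordinates, since those of `X_t`
  -- add up to 1.
  have key' : ∀ (A : Finset (Fin n)) (G : Set Ω),
      MeasurableSet[fullFiltration X τ hX hτ s] G →
      ∫ ω in G, ∏ i ∈ A, (1 - defaultInd τ i t ω) ∂μ =
        ∫ ω in G, ((1 : Fin d → ℝ) ⬝ᵥ (E A.card *ᵥ X s ω)) *
          ∏ i ∈ A, (1 - defaultInd τ i s ω) ∂μ := by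
    intro A G hG
    have e1 : ∀ ω, ∏ i ∈ A, (1 - defaultInd τ i t ω) =
        ∑ l, X t ω l * ∏ i ∈ A, (1 - defaultInd τ i t ω) := fun ω => by
      rw [← Finset.sum_mul, sum_path hb, one_mul]
    simp only [one_dotProduct, Finset.sum_mul]
    rw [integral_finsetSum _ fun l _ => ((bE A.card l).mul (bP A s)).integrable.integrableOn,
      integral_congr_ae (Eventually.of_forall e1),
      integral_finsetSum _ fun l _ => ((bX t l).mul (bP A t)).integrable.integrableOn]
    exact Finset.sum_congr rfl fun l _ => key A l G hG
  constructor
  · refine condExp_pi_eq (fun l => ?_) fun l => ?_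
    · have hint := integrable_sum_ofReal (μ := μ)
        (fun A : Finset (Fin n) => subsetCoeff n u A.card) fun A => (bX t l).mul (bP A t)
      exact hint.congr (Eventually.of_forall fun ω => (hL ω l).symm)
    · have h := condExp_sum_ofReal_eq (μ := μ) hle
        (fun A : Finset (Fin n) => subsetCoeff n u A.card) (fun A => (bX t l).mul (bP A t))
        (fun A => (bE A.card l).mul (bP A s)) (fun A => (mE A.card l).mul (mP A))
        fun A G hG => key A l G hG
      rw [funext fun ω => hL ω l]
      refine h.trans (Eventually.of_forall fun ω => ?_)
      exact (sum_subsets_eq_sum_blocks (X := X) (τ := τ) u s ω (fun m x => (E m *ᵥ x) l)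
        (fun m => by rw [Matrix.mulVec_zero, Pi.zero_apply])).symm
  · have h := condExp_sum_ofReal_eq (μ := μ) hle
      (fun A : Finset (Fin n) => subsetCoeff n u A.card) (fun A => bP A t)
      (fun A => (bS A.card).mul (bP A s)) (fun A => (mS A.card).mul (mP A)) key'
    rw [funext fun ω => exp_numDefaults_eq_sum (τ := τ) u t ω]
    refine h.trans (Eventually.of_forall fun ω => ?_)
    exact (sum_subsets_eq_sum_blocks (X := X) (τ := τ) u s ω
      (fun m x => (1 : Fin d → ℝ) ⬝ᵥ (E m *ᵥ x))
      (fun m => by rw [Matrix.mulVec_zero, dotProduct_zero])).symm
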